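/- Let $n>1$ be an integer, $\langle z,w\rangle=\sum_{j=1}^n z_j\overline{w_j}$ and $|z|=\sqrt{\langle z,z\rangle}$ on $\mathbb{C}^n$, $B=\{z\in\mathbb{C}^n:|z|<1\}$, $S=\{z\in\mathbb{C}^n:|z|=1\}$, and let $\sigma$ be the Lebesgue surface measure on $S$ normalized by $\sigma(S)=1$. For $z,w\in B$ let $$\varphi_w(z)=\frac{w-P_wz-(1-|w|^2)^{1/2}(z-P_wz)}{1-\langle z,w\rangle},\qquad P_wz=\frac{\langle z,w\rangle}{|w|^2}\,w\ (w\neq0),\quad P_0z=0,$$ and let $$g(z)=\frac{n+1}{2n}\int_{|z|}^1(1-t^2)^{n-1}t^{-2n+1}\,dt,\qquad G(z,w)=g(\varphi_w(z))$$ (so that $g(0)=+\infty$); $G$ is the Green function of the invariant Laplacian of $B$. For a nonnegative Borel measure $\mu$ on $B$ define its invariant Green potential $$G_\mu(z)=\int_B G(z,w)\,d\mu(w)\in[0,\infty],\qquad z\in B,$$ its means $$m_p(r,G_\mu)=\left(\int_S G_\mu(r\xi)^p\,d\sigma(\xi)\right)^{1/p},\qquad 0<r<1,$$ and the measure $d\lambda(z)=(1-|z|)^n\,d\mu(z)$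 on $B$. For $\xi\in S$ and $\delta>0$ let $C(\xi,\delta)=\{z\in B:|1-\langle z,\xi\rangle|<\delta\}$. **Theorem.** Let $n>1$, $1<p<\frac{2n-1}{2(n-1)}$, $0\le\gamma<2n$, and let $\mu$ be a nonnegative Borel measure on $B$ such that $\int_B(1-|w|^2)^n\,d\mu(w)<\infty$. Then $$m_p(r,G_\mu)=O\big((1-r)^{\gamma-n}\big)\quad\text{as } r\to1-$$ if and only if $$\left(\int_S\lambda\big(C(\xi,\delta)\big)^p\,d\sigma(\xi)\right)^{1/p}=O(\delta^\gamma)\quad\text{for } 0<\delta<1,$$ that is, with a constant independent of $\delta\in(0,1)$. -/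

import Mathlib

open MeasureTheory Filter Topology
open scoped ENNReal NNReal

noncomputable section

namespace InvariantGreen

/-- The space `ℂⁿ` with its Hermitian norm `|z| = ‖z‖`. -/
abbrev CSpace (n : ℕ) : Type := EuclideanSpace ℂ (Fin n)

/-- The open unit ball `B` of `ℂⁿ`. -/
abbrev UnitBall (n : ℕ) : Set (CSpace n) := Metric.ball 0 1

/-- The unit sphere `S` of `ℂⁿ`. -/
abbrev UnitSphere (n : ℕ) : Set (CSpace n) := Metric.sphere 0 1

/-- The inner product `⟨z, w⟩ = ∑ j, z j * conj (w j)`, linear in the first argument.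
Mathlib's `inner ℂ` is linear in its second argument, whence the swap. -/
def herm {n : ℕ} (z w : CSpace n) : ℂ := inner ℂ w z

/-- The orthogonal projection `P_w z = (⟨z, w⟩ / |w|²) w` onto the line spanned by `w`;
for `w = 0` the formula gives `P_0 z = 0`. -/
def projLine {n : ℕ} (w z : CSpace n) : CSpace n :=
  (herm z w / ((‖w‖ ^ 2 : ℝ) : ℂ)) • w

/-- The involutive automorphism of the ball
`φ_w(z) = (w - P_w z - (1 - |w|²)^{1/2} Q_w z) / (1 - ⟨z, w⟩)`, where `Q_w = I - P_w`. -/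
def ballInvolution {n : ℕ} (w z : CSpace n) : CSpace n :=
  (1 - herm z w)⁻¹ •
    (w - projLine w z - ((Real.sqrt (1 - ‖w‖ ^ 2) : ℝ) : ℂ) • (z - projLine w z))

/-- `g(z) = (n+1)/(2n) ∫_{|z|}^1 (1 - t²)^{n-1} t^{-2n+1} dt`, with values in `[0, ∞]`
(it is used for `n ≥ 1`, where `g(0) = ∞`). -/
def greenRadial {n : ℕ} (z : CSpace n) : ℝ≥0∞ :=
  ENNReal.ofReal (((n : ℝ) + 1) / (2 * n)) *
    ∫⁻ t in Set.Ioo ‖z‖ 1, ENNReal.ofReal ((1 - t ^ 2) ^ (n - 1) * t ^ (-2 * (n : ℤ) + 1))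

/-- Green's function `G(z, w) = g(φ_w(z))` of the invariant Laplacian. -/
def green {n : ℕ} (z w : CSpace n) : ℝ≥0∞ := greenRadial (ballInvolution w z)

/-- The invariant Green potential `G_μ(z) = ∫_B G(z, w) dμ(w)`, with values in `[0, ∞]`. -/
def greenPotential {n : ℕ} (μ : Measure (UnitBall n)) (z : CSpace n) : ℝ≥0∞ :=
  ∫⁻ w, green z (w : CSpace n) ∂μ

/-- The Lebesgue surface measure `σ` on `S`, normalized so that `σ(S) = 1`. -/
def sphereMeasure (n : ℕ) : Measure (UnitSphere n) :=
  ((volume : Measure (CSpace n)).toSphere Set.univ)⁻¹ • (volume : Measure (CSpace n)).toSphere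

/-- The `p`-th mean `m_p(r, u) = (∫_S u(rξ)^p dσ(ξ))^{1/p}` of a nonnegative function. -/
def sphereMean {n : ℕ} (p r : ℝ) (u : CSpace n → ℝ≥0∞) : ℝ≥0∞ :=
  (∫⁻ ξ : UnitSphere n, u ((r : ℂ) • (ξ : CSpace n)) ^ p ∂(sphereMeasure n)) ^ (1 / p)

/-- The weighted measure `dλ(z) = (1 - |z|)ⁿ dμ(z)` on `B`. -/
def weightedMeasure {n : ℕ} (μ : Measure (UnitBall n)) : Measure (UnitBall n) :=
  μ.withDensity fun z => ENNReal.ofReal ((1 - ‖(z : CSpace n)‖) ^ n)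

/-- The set `C(ξ, δ) = {z ∈ B : d(z, ξ) < δ^{1/2}}` for the anisotropic metric
`d(a, b) = |1 - ⟨a, b⟩|^{1/2}`, that is `{z ∈ B : |1 - ⟨z, ξ⟩| < δ}`. -/
def anisoCap {n : ℕ} (ξ : UnitSphere n) (δ : ℝ) : Set (UnitBall n) :=
  {z | ‖1 - herm (z : CSpace n) (ξ : CSpace n)‖ < δ}

end InvariantGreen

end

/-! Everything rests on the identity 1 - |φ_w(z)|² = A, where A = (1-|z|²)(1-|w|²)/|1-⟨z,w⟩|² is
`invRatio`. By it G(z,w) is at least a multiple of Aⁿ, and at most a multiple of Aⁿ plus a singular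
term (1-A)^{-(n-1)} living on A > 3/4.

Means to caps: for w in C(ξ,δ) and z = (1-δ)ξ one has |1-⟨z,w⟩| ≤ 2δ, so A ≥ (1-|w|)/(4δ) and
λ(C(ξ,δ)) ≤ K δⁿ G_μ(z); it remains to take L^p norms in ξ (`caps_of_means`). Values of δ away from
0 are covered by λ(B) < ∞.

Caps to means: with δ = 1-r, `exists_greenPotential_le` bounds G_μ(rξ) by a Poisson type integral
and δ^{-n} times a local singular integral, both against λ. The Poisson kernel is cut into dyadic
caps of radius about 2^k δ with coefficients 2^{-2nk} δ^{-n}; the hypothesis on caps turns this into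
a geometric series of ratio 2^{γ-2n}, which converges because γ < 2n (`exists_poisson_mean_le`).

For the local part (`exists_near_mean_le`), Jensen's inequality moves the power p onto the kernel,
and Tonelli reduces matters to the integral of (1-A)^{-(n-1)p} over ξ. The sphere has real dimension
2n-1 and 1-A vanishes like a squared distance, so integrability holds when 2(n-1)p < 2n-1, which is
the hypothesis on p. That integral is then O(δⁿ), comparable to the measure of a cap
(`exists_lintegral_nearKernel_le`), and a second use of Tonelli with the quasi-triangle inequality
returns the L^p norm of cap measures. -/

namespace InvariantGreen

/-! ### Size of the Green function -/

/-- The quantity `(1 - |z|²)(1 - |w|²) / |1 - ⟨z, w⟩|²`, which equals `1 - |φ_w(z)|²`. -/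
noncomputable def invRatio {n : ℕ} (z w : CSpace n) : ℝ :=
  (1 - ‖z‖ ^ 2) * (1 - ‖w‖ ^ 2) / ‖1 - herm z w‖ ^ 2

lemma norm_herm_le {n : ℕ} (z w : CSpace n) : ‖herm z w‖ ≤ ‖z‖ * ‖w‖ := by
  rw [mul_comm]; exact norm_inner_le_norm w z

lemma one_sub_mul_le_norm_one_sub_herm {n : ℕ} (z w : CSpace n) :
    1 - ‖z‖ * ‖w‖ ≤ ‖1 - herm z w‖ := by
  have h := norm_sub_norm_le (1 : ℂ) (herm z w)
  have h' := norm_herm_le z w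
  rw [norm_one] at h
  linarith

lemma norm_one_sub_herm_pos {n : ℕ} {z w : CSpace n} (hz : ‖z‖ < 1) (hw : ‖w‖ < 1) :
    0 < ‖1 - herm z w‖ := by
  have h := one_sub_mul_le_norm_one_sub_herm z w
  nlinarith [norm_nonneg z, norm_nonneg w]

lemma norm_one_sub_sq (u : ℂ) : ‖1 - u‖ ^ 2 = 1 - 2 * u.re + ‖u‖ ^ 2 := by
  rw [← Complex.normSq_eq_norm_sq, ← Complex.normSq_eq_norm_sq, Complex.normSq_apply,
    Complex.normSq_apply]
  simp; ring

/-- Pythagoras: w - P_w z is a multiple of w and z - P_w z is orthogonal to w, so the squared norm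
of the numerator splits. The rest is algebra in α = ⟨z,w⟩. -/
lemma norm_ballInvolution_sq {n : ℕ} {z w : CSpace n} (hz : ‖z‖ < 1) (hw : ‖w‖ < 1) :
    ‖ballInvolution w z‖ ^ 2 = 1 - invRatio z w := by
  have hD : 0 < ‖1 - herm z w‖ := norm_one_sub_herm_pos hz hw
  have hw1 : 0 ≤ 1 - ‖w‖ ^ 2 := by nlinarith [norm_nonneg w]
  rcases eq_or_ne w 0 with rfl | hw0
  · simp [ballInvolution, projLine, invRatio, herm]
  have hwn : ‖w‖ ≠ 0 := norm_ne_zero_iff.2 hw0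
  set α := herm z w with hα
  set P := projLine w z with hP
  have hPw : P = (α / ((‖w‖ ^ 2 : ℝ) : ℂ)) • w := rfl
  have hww : inner ℂ w w = ((‖w‖ ^ 2 : ℝ) : ℂ) := by
    rw [inner_self_eq_norm_sq_to_K]; simp
  have hwc : ((‖w‖ ^ 2 : ℝ) : ℂ) ≠ 0 := by exact_mod_cast pow_ne_zero 2 hwn
  have horth : inner ℂ w (z - P) = 0 := by
    rw [hPw, inner_sub_right, inner_smul_right, hww]
    change α - _ = 0
    field_simp
    simp
  have hPn : ‖P‖ ^ 2 = ‖α‖ ^ 2 / ‖w‖ ^ 2 := by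
    rw [hPw, norm_smul, norm_div]
    simp only [Complex.norm_real, norm_pow, norm_norm]
    field_simp
  have hwP : w - P = (1 - α / ((‖w‖ ^ 2 : ℝ) : ℂ)) • w := by rw [hPw]; module
  have hzP : ‖z - P‖ ^ 2 = ‖z‖ ^ 2 - ‖α‖ ^ 2 / ‖w‖ ^ 2 := by
    have h1 : inner ℂ P (z - P) = 0 := by
      rw [hPw] at horth ⊢
      rw [inner_smul_left, horth, mul_zero]
    have h2 := norm_add_sq_eq_norm_sq_add_norm_sq_of_inner_eq_zero P (z - P) h1
    rw [add_sub_cancel] at h2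
    rw [← hPn]; nlinarith
  have hnum : ‖w - P - ((Real.sqrt (1 - ‖w‖ ^ 2) : ℝ) : ℂ) • (z - P)‖ ^ 2
      = ‖w - P‖ ^ 2 + (1 - ‖w‖ ^ 2) * ‖z - P‖ ^ 2 := by
    have h1 : inner ℂ (w - P) (-(((Real.sqrt (1 - ‖w‖ ^ 2) : ℝ) : ℂ) • (z - P))) = 0 := by
      rw [hwP, inner_smul_left, inner_neg_right, inner_smul_right, horth]; simp
    have h2 := norm_add_sq_eq_norm_sq_add_norm_sq_of_inner_eq_zero _ _ h1
    rw [← sub_eq_add_neg, norm_neg, norm_smul] at h2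
    have h3 := Real.mul_self_sqrt hw1
    rw [Complex.norm_real, Real.norm_eq_abs, abs_of_nonneg (Real.sqrt_nonneg _)] at h2
    rw [pow_two, h2]
    linear_combination ‖z - P‖ ^ 2 * h3
  have hwPn : ‖w - P‖ ^ 2 = ‖w‖ ^ 2 - 2 * α.re + ‖α‖ ^ 2 / ‖w‖ ^ 2 := by
    rw [hwP, norm_smul, mul_pow, norm_one_sub_sq, norm_div, Complex.div_ofReal_re]
    simp only [Complex.norm_real, norm_pow, norm_norm]
    field_simp
  rw [ballInvolution, ← hα, ← hP, norm_smul, mul_pow, hnum, hwPn, hzP, invRatio, ← hα, norm_inv]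
  rw [eq_sub_iff_add_eq, inv_pow, ← div_eq_inv_mul, ← add_div, div_eq_one_iff_eq (by positivity),
    norm_one_sub_sq]
  field_simp
  ring

lemma invRatio_pos {n : ℕ} {z w : CSpace n} (hz : ‖z‖ < 1) (hw : ‖w‖ < 1) :
    0 < invRatio z w := by
  have hD : 0 < ‖1 - herm z w‖ := norm_one_sub_herm_pos hz hw
  have h1 : 0 < 1 - ‖w‖ ^ 2 := by nlinarith [norm_nonneg w]
  have h2 : 0 < 1 - ‖z‖ ^ 2 := by nlinarith [norm_nonneg z]
  unfold invRatio; positivity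

lemma norm_ballInvolution_lt_one {n : ℕ} {z w : CSpace n} (hz : ‖z‖ < 1) (hw : ‖w‖ < 1) :
    ‖ballInvolution w z‖ < 1 := by
  have := norm_ballInvolution_sq hz hw
  have := invRatio_pos hz hw
  nlinarith [norm_nonneg (ballInvolution w z)]

/-- The Green function is bounded below by `(1 - |z|²)ⁿ`. -/
lemma exists_le_greenRadial (n : ℕ) (hn : 1 < n) :
    ∃ c : ℝ, 0 < c ∧ ∀ x : CSpace n, ‖x‖ < 1 →
      ENNReal.ofReal (c * (1 - ‖x‖ ^ 2) ^ n) ≤ greenRadial x := by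
  refine ⟨((n : ℝ) + 1) / (2 * n) * (1 / 4) ^ n, by positivity, fun x hx => ?_⟩
  set ρ := ‖x‖ with hρ
  have hρ0 : 0 ≤ ρ := norm_nonneg x
  rw [greenRadial, mul_assoc, ENNReal.ofReal_mul (by positivity)]
  gcongr
  -- On the left half of (ρ, 1) one has 1 - t² ≥ (1-ρ)/2 and t^{1-2n} ≥ 1. The factor (1/4)ⁿ comes
  -- from (1-ρ²)/4 ≤ (1-ρ)/2.
  have hsub : Set.Ioo ρ ((1 + ρ) / 2) ⊆ Set.Ioo ρ 1 := Set.Ioo_subset_Ioo_right (by linarith)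
  calc ENNReal.ofReal ((1 / 4) ^ n * (1 - ρ ^ 2) ^ n)
      ≤ ENNReal.ofReal (((1 - ρ) / 2) ^ (n - 1) * ((1 - ρ) / 2)) := by
        apply ENNReal.ofReal_le_ofReal
        rw [← pow_succ, Nat.sub_add_cancel (by omega), ← mul_pow]
        have : 0 ≤ 1 - ρ ^ 2 := by nlinarith
        gcongr
        nlinarith
    _ = ∫⁻ _t in Set.Ioo ρ ((1 + ρ) / 2), ENNReal.ofReal (((1 - ρ) / 2) ^ (n - 1)) := by
        rw [setLIntegral_const, Real.volume_Ioo, ← ENNReal.ofReal_mul (by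
          have : 0 ≤ 1 - ρ := by linarith
          positivity)]
        congr 2; ring
    _ ≤ ∫⁻ t in Set.Ioo ρ ((1 + ρ) / 2),
          ENNReal.ofReal ((1 - t ^ 2) ^ (n - 1) * t ^ (-2 * (n : ℤ) + 1)) := by
        apply setLIntegral_mono' measurableSet_Ioo
        intro t ht
        apply ENNReal.ofReal_le_ofReal
        have ht0 : 0 < t := lt_of_le_of_lt hρ0 ht.1
        have ht1 : t < 1 := by linarith [ht.2]
        have h1 : 1 ≤ t ^ (-2 * (n : ℤ) + 1) := by
          have : (-2 * (n : ℤ) + 1) = -((2 * n - 1 : ℕ) : ℤ) := by omega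
          rw [this, zpow_neg, zpow_natCast]
          exact (one_le_inv₀ (by positivity)).2 (pow_le_one₀ ht0.le ht1.le)
        have h2 : ((1 - ρ) / 2) ^ (n - 1) ≤ (1 - t ^ 2) ^ (n - 1) := by
          apply pow_le_pow_left₀ (by linarith)
          nlinarith [ht.2]
        have h3 : 0 ≤ (1 - t ^ 2) ^ (n - 1) := pow_nonneg (by nlinarith) _
        nlinarith
    _ ≤ _ := lintegral_mono_set hsub

/-- The Green function is comparable to `(1 - |z|²)ⁿ` away from `0`, and has a singularity of order
at most `|z|^{-2(n-1)}` at `0`. -/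
lemma exists_greenRadial_le (n : ℕ) (hn : 1 < n) :
    ∃ C : ℝ≥0, ∀ x : CSpace n, ‖x‖ < 1 →
      greenRadial x ≤ C * (ENNReal.ofReal ((1 - ‖x‖ ^ 2) ^ n) +
        if ‖x‖ ^ 2 < 1 / 4 then ENNReal.ofReal (‖x‖ ^ 2) ^ (-((n : ℝ) - 1)) else 0) := by
  have hn' : (1 : ℝ) < n := by exact_mod_cast hn
  refine ⟨Real.toNNReal (((n : ℝ) + 1) / (2 * n)) *
    (2 ^ (n - 1) * 2 ^ (2 * n - 1)), fun x hx => ?_⟩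
  set ρ := ‖x‖ with hρ
  have hρ0 : 0 ≤ ρ := norm_nonneg x
  rw [greenRadial, ENNReal.coe_mul, mul_assoc]
  gcongr
  · exact le_rfl
  have hone : (1 : ℝ≥0∞) ≤ ((2 ^ (n - 1) * 2 ^ (2 * n - 1) : ℝ≥0) : ℝ≥0∞) := by
    rw [ENNReal.one_le_coe_iff]
    exact one_le_mul (one_le_pow₀ one_le_two) (one_le_pow₀ one_le_two)
  split_ifs with h
  · refine le_trans ?_ (mul_le_mul hone (self_le_add_left _ _) (zero_le) (zero_le))
    rw [one_mul]
    rcases eq_or_lt_of_le hρ0 with h0 | hpos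
    · rw [← h0]
      -- At the centre the right side is a negative power of 0, hence ∞.
      simp [ENNReal.zero_rpow_of_neg, hn']
    calc ∫⁻ t in Set.Ioo ρ 1, ENNReal.ofReal ((1 - t ^ 2) ^ (n - 1) * t ^ (-2 * (n : ℤ) + 1))
        ≤ ∫⁻ t in Set.Ioo ρ 1, ENNReal.ofReal (t ^ (-2 * (n : ℝ) + 1)) := by
          apply setLIntegral_mono' measurableSet_Ioo
          intro t ht
          apply ENNReal.ofReal_le_ofReal
          have ht0 : 0 < t := hpos.trans ht.1
          have : t ^ (-2 * (n : ℝ) + 1) = t ^ (-2 * (n : ℤ) + 1) := by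
            rw [← Real.rpow_intCast]; push_cast; rfl
          rw [this]
          apply mul_le_of_le_one_left (by positivity)
          apply pow_le_one₀ <;> nlinarith [ht.2]
      _ ≤ ∫⁻ t in Set.Ioi ρ, ENNReal.ofReal (t ^ (-2 * (n : ℝ) + 1)) :=
          lintegral_mono_set Set.Ioo_subset_Ioi_self
      _ = ENNReal.ofReal (-ρ ^ (-2 * (n : ℝ) + 1 + 1) / (-2 * (n : ℝ) + 1 + 1)) := by
          rw [← integral_Ioi_rpow_of_lt (by linarith) hpos, ofReal_integral_eq_lintegral_ofReal]
          · exact integrableOn_Ioi_rpow_of_lt (by linarith) hpos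
          · filter_upwards [ae_restrict_mem measurableSet_Ioi] with t ht
            exact Real.rpow_nonneg (hpos.trans ht).le _
      _ ≤ ENNReal.ofReal (ρ ^ (-2 * (n : ℝ) + 1 + 1)) := by
          apply ENNReal.ofReal_le_ofReal
          rw [neg_div, ← div_neg]
          apply div_le_self (by positivity)
          have : (2 : ℝ) ≤ n := by exact_mod_cast hn
          linarith
      _ = _ := by
          rw [ENNReal.ofReal_rpow_of_pos (by positivity), ← Real.rpow_natCast_mul hρ0]
          congr 2; push_cast; ring
  · rw [add_zero]
    have hhalf : 1 / 2 ≤ ρ := by nlinarith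
    calc ∫⁻ t in Set.Ioo ρ 1, ENNReal.ofReal ((1 - t ^ 2) ^ (n - 1) * t ^ (-2 * (n : ℤ) + 1))
        ≤ ∫⁻ t in Set.Ioo ρ 1, ENNReal.ofReal ((2 * (1 - ρ)) ^ (n - 1) * 2 ^ (2 * n - 1)) := by
          apply setLIntegral_mono' measurableSet_Ioo
          intro t ht
          apply ENNReal.ofReal_le_ofReal
          have ht0 : 1 / 2 < t := lt_of_le_of_lt hhalf ht.1
          have e : (-2 * (n : ℤ) + 1) = -((2 * n - 1 : ℕ) : ℤ) := by omega
          rw [e, zpow_neg, zpow_natCast, ← inv_pow]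
          have : t⁻¹ ≤ 2 := by rw [inv_le_comm₀ (by linarith) (by norm_num)]; linarith
          have h2 : 0 ≤ 1 - t ^ 2 := by nlinarith [ht.2]
          have h3 : 1 - t ^ 2 ≤ 2 * (1 - ρ) := by nlinarith [ht.2, ht.1]
          gcongr
      _ = ENNReal.ofReal ((2 * (1 - ρ)) ^ (n - 1) * 2 ^ (2 * n - 1)) * ENNReal.ofReal (1 - ρ) := by
          rw [setLIntegral_const, Real.volume_Ioo]
      _ = ENNReal.ofReal (2 ^ (n - 1) * 2 ^ (2 * n - 1) * (1 - ρ) ^ n) := by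
          have h1 : 0 ≤ 1 - ρ := by linarith
          rw [← ENNReal.ofReal_mul (by positivity)]
          congr 1
          obtain ⟨m, rfl⟩ : ∃ m, n = m + 1 := ⟨n - 1, by omega⟩
          simp only [Nat.add_sub_cancel, pow_succ, mul_pow]
          ring
      _ ≤ ENNReal.ofReal (2 ^ (n - 1) * 2 ^ (2 * n - 1) * (1 - ρ ^ 2) ^ n) := by
          apply ENNReal.ofReal_le_ofReal
          have h1 : 0 ≤ 1 - ρ := by linarith
          have : 1 - ρ ≤ 1 - ρ ^ 2 := by nlinarith
          gcongr
      _ = _ := by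
          rw [ENNReal.ofReal_mul (by positivity)]
          congr 1
          rw [← ENNReal.ofReal_coe_nnreal]
          push_cast; rfl

lemma exists_le_green (n : ℕ) (hn : 1 < n) :
    ∃ c : ℝ, 0 < c ∧ ∀ z w : CSpace n, ‖z‖ < 1 → ‖w‖ < 1 →
      ENNReal.ofReal (c * invRatio z w ^ n) ≤ green z w := by
  obtain ⟨c, hc, h⟩ := exists_le_greenRadial n hn
  refine ⟨c, hc, fun z w hz hw => ?_⟩
  have := h _ (norm_ballInvolution_lt_one hz hw)
  rwa [norm_ballInvolution_sq hz hw, sub_sub_cancel] at this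

lemma exists_green_le (n : ℕ) (hn : 1 < n) :
    ∃ C : ℝ≥0, ∀ z w : CSpace n, ‖z‖ < 1 → ‖w‖ < 1 →
      green z w ≤ C * (ENNReal.ofReal (invRatio z w ^ n) +
        if 3 / 4 < invRatio z w then
          ENNReal.ofReal (1 - invRatio z w) ^ (-((n : ℝ) - 1)) else 0) := by
  obtain ⟨C, h⟩ := exists_greenRadial_le n hn
  refine ⟨C, fun z w hz hw => ?_⟩
  have := h _ (norm_ballInvolution_lt_one hz hw)
  rw [norm_ballInvolution_sq hz hw, sub_sub_cancel] at this
  refine this.trans_eq ?_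
  congr 3
  rw [eq_iff_iff]
  constructor <;> intro <;> linarith

/-! ### Integration on the sphere through unitary coordinates -/

instance {n : ℕ} [NeZero n] : IsProbabilityMeasure (sphereMeasure n) := by
  have : Nonempty (Fin n) := ⟨0⟩
  have : Nontrivial (CSpace n) := inferInstance
  constructor
  rw [sphereMeasure, Measure.smul_apply, smul_eq_mul]
  exact ENNReal.inv_mul_cancel (by
    rw [ne_eq, Measure.measure_univ_eq_zero]; exact Measure.toSphere_ne_zero _)
    (measure_ne_top _ _)

/-- A function on the sphere dominated along every ray in the ball has its integral dominated. -/
lemma lintegral_toSphere_le {E : Type*} [NormedAddCommGroup E] [NormedSpace ℝ E]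
    [MeasurableSpace E] [BorelSpace E] (μ : Measure E) (f : Metric.sphere (0 : E) 1 → ℝ≥0∞)
    (F : E → ℝ≥0∞)
    (h : ∀ ξ : Metric.sphere (0 : E) 1, ∀ t : ℝ, 0 < t → t < 1 → f ξ ≤ F (t • (ξ : E))) :
    ∫⁻ ξ, f ξ ∂μ.toSphere ≤ (Module.finrank ℝ E : ℝ≥0∞) * ∫⁻ x, F x ∂μ := by
  have he : MeasurableEmbedding (Subtype.val ∘ (homeomorphUnitSphereProd E).symm) :=
    (MeasurableEmbedding.subtype_coe (measurableSet_singleton _).compl).comp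
      (Homeomorph.measurableEmbedding _)
  rw [Measure.toSphere, lintegral_smul_measure, nsmul_eq_mul]
  gcongr
  rw [Measure.fst]
  refine (lintegral_map_le _ _).trans ?_
  -- `Measure.toSphere` is the dimension times the marginal on directions of the measure on radii t
  -- < 1, so the hypothesis applies pointwise on the cone.
  calc _ ≤ ∫⁻ q in (Set.univ ×ˢ Set.Iio ⟨1, Set.mem_Ioi.2 one_pos⟩),
        F ((Subtype.val ∘ (homeomorphUnitSphereProd E).symm) q)
          ∂(μ.comap (Subtype.val ∘ (homeomorphUnitSphereProd E).symm)) := by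
        refine setLIntegral_mono' (MeasurableSet.univ.prod measurableSet_Iio) ?_
        rintro ⟨ξ, t⟩ ht
        exact h ξ t t.2 ht.2
    _ ≤ ∫⁻ q, F ((Subtype.val ∘ (homeomorphUnitSphereProd E).symm) q)
          ∂(μ.comap (Subtype.val ∘ (homeomorphUnitSphereProd E).symm)) :=
        setLIntegral_le_lintegral _ _
    _ = ∫⁻ x in Set.range (Subtype.val ∘ (homeomorphUnitSphereProd E).symm), F x ∂μ := by
        rw [← he.map_comap, he.lintegral_map]
    _ ≤ _ := setLIntegral_le_lintegral _ _

/-- Extend e to an orthonormal basis, so that ⟨·,e⟩ becomes the first coordinate. The constant c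
compares the Euclidean volume with the product volume; it does not depend on e because unitary maps
preserve volume. -/
lemma exists_coordinates (m : ℕ) : ∃ c : ℝ≥0, c ≠ 0 ∧ ∀ e : CSpace (m + 1), ‖e‖ = 1 →
    ∃ U : CSpace (m + 1) ≃ₗᵢ[ℂ] CSpace (m + 1), (∀ x, herm x e = U x 0) ∧
      Measure.map (fun x => (U x).ofLp) (volume : Measure (CSpace (m + 1))) =
        c • (volume : Measure (Fin (m + 1) → ℂ)) := by
  let L : CSpace (m + 1) ≃L[ℂ] (Fin (m + 1) → ℂ) := EuclideanSpace.equiv (Fin (m + 1)) ℂ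
  have : (Measure.map L (volume : Measure (CSpace (m + 1)))).IsAddHaarMeasure :=
    L.isAddHaarMeasure_map _
  refine ⟨_, (Measure.addHaarScalarFactor_pos_of_isAddHaarMeasure
    (Measure.map L (volume : Measure (CSpace (m + 1)))) volume).ne', fun e he => ?_⟩
  have horth : Orthonormal ℂ
      (({0} : Set (Fin (m + 1))).domRestrict (fun _ => e)) := by
    constructor
    · intro i; exact he
    · intro i j hij; exact absurd (Subsingleton.elim i j) hij
  obtain ⟨b, hb⟩ := horth.exists_orthonormalBasis_extension_of_card_eq (by simp)
  refine ⟨b.repr, fun x => ?_, ?_⟩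
  · rw [b.repr_apply_apply, hb 0 rfl]; rfl
  · let V : CSpace (m + 1) ≃ₗᵢ[ℝ] CSpace (m + 1) :=
      { b.repr.toLinearEquiv.restrictScalars ℝ with norm_map' := b.repr.norm_map }
    have hV := V.measurePreserving
    rw [← Measure.isAddLeftInvariant_eq_smul]
    conv_rhs => rw [← hV.map_eq]
    rw [Measure.map_map L.continuous.measurable V.continuous.measurable]
    rfl

lemma lintegral_pi_prod {n : ℕ} (f : Fin n → ℂ → ℝ≥0∞) (hf : ∀ i, Measurable (f i)) :
    ∫⁻ x : Fin n → ℂ, ∏ i, f i (x i) = ∏ i, ∫⁻ ζ, f i ζ := by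
  induction n with
  | zero => simp [volume_pi]
  | succ n ih =>
    have := (volume_preserving_piFinSuccAbove (fun _ : Fin (n + 1) => ℂ) 0)
    rw [Fin.prod_univ_succ, ← ih _ (fun i => hf i.succ),
      ← lintegral_prod_mul (hf 0).aemeasurable
        (Finset.measurable_prod _ fun i _ => (hf i.succ).comp (measurable_pi_apply i)).aemeasurable,
      ← Measure.volume_eq_prod,
      ← this.lintegral_comp_emb (MeasurableEquiv.measurableEmbedding _)]
    congr 1 with x
    rw [Fin.prod_univ_succ]
    rfl

/-! ### Integrals over nonisotropic caps and the measure of caps -/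

/-- The function `|t|^{-β}` cut off to `[-R, R]`. -/
noncomputable def cutPower (β R t : ℝ) : ℝ≥0∞ :=
  (Set.Icc (-R) R).indicator (fun t => ENNReal.ofReal |t| ^ (-β)) t

@[fun_prop]
lemma measurable_cutPower (β R : ℝ) : Measurable (cutPower β R) := by
  unfold cutPower
  exact Measurable.indicator (by fun_prop) measurableSet_Icc

lemma lintegral_cutPower {β : ℝ} (hβ : β < 1) {R : ℝ} (hR : 0 < R) :
    ∫⁻ t, cutPower β R t = ENNReal.ofReal (2 / (1 - β) * R ^ (1 - β)) := by
  have h1 : ∫⁻ t in Set.Ioc 0 R, ENNReal.ofReal |t| ^ (-β) =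
      ENNReal.ofReal (R ^ (1 - β) / (1 - β)) := by
    have : ∫ t in (0 : ℝ)..R, t ^ (-β) = R ^ (1 - β) / (1 - β) := by
      rw [integral_rpow (Or.inl (by linarith)), Real.zero_rpow (by linarith)]
      rw [sub_zero]; congr 1 <;> ring_nf
    rw [← this, intervalIntegral.integral_of_le hR.le, ofReal_integral_eq_lintegral_ofReal]
    · refine setLIntegral_congr_fun measurableSet_Ioc fun t ht => ?_
      rw [abs_of_pos ht.1, ENNReal.ofReal_rpow_of_pos ht.1]
    · exact (intervalIntegral.intervalIntegrable_rpow' (by linarith)).1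
    · filter_upwards [ae_restrict_mem measurableSet_Ioc] with t ht
      exact Real.rpow_nonneg ht.1.le _
  have h2 : ∫⁻ t in Set.Ico (-R) 0, ENNReal.ofReal |t| ^ (-β) =
      ENNReal.ofReal (R ^ (1 - β) / (1 - β)) := by
    rw [← h1, ← lintegral_indicator measurableSet_Ioc, ← lintegral_indicator measurableSet_Ico,
      ← lintegral_neg_eq_self]
    congr 1 with t
    simp only [Set.indicator, Set.mem_Ico, Set.mem_Ioc, abs_neg]
    congr 1
    rw [eq_iff_iff]; constructor <;> rintro ⟨h, h'⟩ <;> constructor <;> linarith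
  simp only [cutPower]
  rw [lintegral_indicator measurableSet_Icc,
    ← setLIntegral_congr (Ioc_ae_eq_Icc (μ := volume) (a := -R) (b := R)),
    ← Set.Ioc_union_Ioc_eq_Ioc (show -R ≤ 0 by linarith) hR.le,
    lintegral_union measurableSet_Ioc (Set.Ioc_disjoint_Ioc_of_le le_rfl), h1,
    setLIntegral_congr (Ioc_ae_eq_Icc (μ := volume) (a := -R) (b := 0)),
    ← setLIntegral_congr (Ico_ae_eq_Icc (μ := volume) (a := -R) (b := 0)), h2,
    ← ENNReal.ofReal_add]
  · congr 1; ring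
  all_goals
    have : 0 < 1 - β := by linarith
    positivity

lemma lintegral_complex_mul {f g : ℝ → ℝ≥0∞} (hf : Measurable f) (hg : Measurable g) :
    ∫⁻ ζ : ℂ, f ζ.re * g ζ.im = (∫⁻ t, f t) * ∫⁻ t, g t := by
  rw [← lintegral_prod_mul hf.aemeasurable hg.aemeasurable, ← Measure.volume_eq_prod,
    ← Complex.volume_preserving_equiv_real_prod.lintegral_comp_emb
      (MeasurableEquiv.measurableEmbedding _)]
  rfl

lemma ennreal_rpow_neg_anti {x y : ℝ≥0∞} {b : ℝ} (hb : 0 ≤ b) (h : x ≤ y) :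
    y ^ (-b) ≤ x ^ (-b) := by
  rw [ENNReal.rpow_neg, ENNReal.rpow_neg]
  exact ENNReal.inv_le_inv.2 (ENNReal.rpow_le_rpow h hb)

@[fun_prop]
lemma continuous_herm {n : ℕ} {X : Type*} [TopologicalSpace X] {f g : X → CSpace n}
    (hf : Continuous f) (hg : Continuous g) : Continuous fun x => herm (f x) (g x) := by
  unfold herm; exact hg.inner hf

lemma herm_smul_left {n : ℕ} (t : ℝ) (x e : CSpace n) : herm (t • x) e = t * herm x e := by
  unfold herm; rw [inner_smul_right_eq_smul]; simp

lemma norm_sq_eq_sum (m : ℕ) (x : CSpace (m + 1)) :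
    ‖x‖ ^ 2 = ‖x 0‖ ^ 2 + ∑ j : Fin m, ‖x j.succ‖ ^ 2 := by
  rw [EuclideanSpace.norm_sq_eq, Fin.sum_univ_succ]

lemma le_cutPower {β R t s : ℝ} (hβ : 0 ≤ β) (htR : |t| ≤ R) (hts : |t| ≤ s) :
    ENNReal.ofReal s ^ (-β) ≤ cutPower β R t := by
  rw [cutPower, Set.indicator_of_mem (Set.mem_Icc.2 (abs_le.1 htR))]
  exact ennreal_rpow_neg_anti hβ (ENNReal.ofReal_le_ofReal hts)

/-- The majorant, on the unit ball, of the homogeneous function estimated in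
`exists_lintegral_cap_le`. -/
noncomputable def capMajorant (m : ℕ) (a b η : ℝ) (i : Fin (m + 1)) (ζ : ℂ) : ℝ≥0∞ :=
  Fin.cases (motive := fun _ => ℝ≥0∞) (cutPower 0 1 ζ.re * cutPower a η ζ.im)
    (fun _ => cutPower (b / m) (√(2 * η)) ζ.re * cutPower (b / m) (√(2 * η)) ζ.im) i

lemma measurable_capMajorant (m : ℕ) (a b η : ℝ) (i : Fin (m + 1)) :
    Measurable (capMajorant m a b η i) := by
  refine Fin.cases ?_ (fun j => ?_) i
  · change Measurable fun ζ : ℂ => cutPower 0 1 ζ.re * cutPower a η ζ.im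
    fun_prop
  · change Measurable fun ζ : ℂ =>
      cutPower (b / m) (√(2 * η)) ζ.re * cutPower (b / m) (√(2 * η)) ζ.im
    fun_prop

/-- The exponent b is shared equally among the m transverse coordinates; each real factor then has
exponent b/m < 1 and is integrable. The first coordinate contributes η^{1-a} and each other one
η^{1-b/m}. -/
lemma prod_lintegral_capMajorant (m : ℕ) (hm : 0 < m) {a b η : ℝ} (ha1 : a < 1)
    (hb : b < m) (hη : 0 < η) :
    ∏ i, ∫⁻ ζ, capMajorant m a b η i ζ = ENNReal.ofReal
      (4 / (1 - a) * ((2 / (1 - b / m)) ^ 2 * 2 ^ (1 - b / m)) ^ m * η ^ (m + 1 - a - b)) := by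
  have hm' : (0 : ℝ) < m := by exact_mod_cast hm
  have hβ : b / m < 1 := (div_lt_one hm').2 hb
  have h0 : 0 < 1 - b / m := by linarith
  have h0' : 0 < 1 - a := by linarith
  have hR : 0 < √(2 * η) := by positivity
  rw [Fin.prod_univ_succ]
  have e0 : ∫⁻ ζ, capMajorant m a b η 0 ζ = ENNReal.ofReal (4 / (1 - a) * η ^ (1 - a)) := by
    change ∫⁻ ζ : ℂ, cutPower 0 1 ζ.re * cutPower a η ζ.im = _
    rw [lintegral_complex_mul (by fun_prop) (by fun_prop), lintegral_cutPower one_pos one_pos,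
      lintegral_cutPower ha1 hη, ← ENNReal.ofReal_mul (by positivity)]
    congr 1; simp; ring
  have e1 (j : Fin m) : ∫⁻ ζ, capMajorant m a b η j.succ ζ =
      ENNReal.ofReal ((2 / (1 - b / m)) ^ 2 * (2 * η) ^ (1 - b / m)) := by
    change ∫⁻ ζ : ℂ, cutPower (b / m) (√(2 * η)) ζ.re * cutPower (b / m) (√(2 * η)) ζ.im = _
    rw [lintegral_complex_mul (by fun_prop) (by fun_prop), lintegral_cutPower hβ hR,
      ← ENNReal.ofReal_mul (by positivity)]
    congr 1
    rw [mul_mul_mul_comm, ← Real.mul_rpow hR.le hR.le, Real.mul_self_sqrt (by positivity)]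
    ring
  rw [e0, Finset.prod_congr rfl fun j _ => e1 j, Finset.prod_const, Finset.card_univ,
    Fintype.card_fin, ← ENNReal.ofReal_pow (by positivity), ← ENNReal.ofReal_mul (by positivity)]
  congr 1
  rw [Real.mul_rpow zero_le_two hη.le, ← mul_assoc, mul_pow _ (η ^ _), ← Real.rpow_mul_natCast hη.le]
  have : η ^ (m + 1 - a - b) = η ^ (1 - a) * η ^ ((1 - b / m) * m) := by
    rw [← Real.rpow_add hη]; congr 1; field_simp; ring
  rw [this]; ring

/-- Here x represents tξ in coordinates and u = ⟨ξ,e⟩. Each transverse coordinate satisfies |Re x_j|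
|Im x_j| ≤ |x_j|² ≤ 1-|u|² ≤ 2η, so (1-|u|²)^{-b}, split into m equal powers, is dominated factor by
factor. -/
lemma prod_capMajorant_ge (m : ℕ) (hm : 0 < m) {a b η t : ℝ} (ha : 0 ≤ a) (hb0 : 0 ≤ b)
    (ht0 : 0 < t) (ht1 : t < 1) {u : ℂ} {x : CSpace (m + 1)} (hx0 : x 0 = t * u) (hxn : ‖x‖ = t)
    (hu1 : ‖u‖ ≤ 1) (hξ' : ‖1 - u‖ < η) :
    ENNReal.ofReal |u.im| ^ (-a) * ENNReal.ofReal (1 - ‖u‖ ^ 2) ^ (-b) ≤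
      ∏ i, capMajorant m a b η i (x.ofLp i) := by
  have hm' : (0 : ℝ) < m := by exact_mod_cast hm
  have hβ0 : 0 ≤ b / m := by positivity
  have hsum := norm_sq_eq_sum m x
  rw [hxn, hx0, norm_mul, Complex.norm_real, Real.norm_eq_abs, abs_of_pos ht0, mul_pow] at hsum
  have hu2 : 1 - ‖u‖ ≤ ‖1 - u‖ := by simpa using norm_sub_norm_le (1 : ℂ) u
  have hj (j : Fin m) : ‖x j.succ‖ ^ 2 ≤ 1 - ‖u‖ ^ 2 := by
    have h1 : ‖x j.succ‖ ^ 2 ≤ ∑ j : Fin m, ‖x j.succ‖ ^ 2 :=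
      Finset.single_le_sum (f := fun j : Fin m => ‖x j.succ‖ ^ 2) (fun i _ => by positivity)
        (Finset.mem_univ j)
    have h2 : 0 ≤ 1 - ‖u‖ ^ 2 := by nlinarith [norm_nonneg u]
    have h3 : 0 ≤ 1 - t ^ 2 := by nlinarith
    nlinarith [mul_nonneg h2 h3]
  have hj' (j : Fin m) : ‖x j.succ‖ ≤ √(2 * η) := by
    apply Real.le_sqrt_of_sq_le
    nlinarith [hj j, norm_nonneg u]
  rw [Fin.prod_univ_succ]
  apply mul_le_mul' ?_ ?_
  · change _ ≤ cutPower 0 1 (x 0).re * cutPower a η (x 0).im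
    rw [hx0, Complex.re_ofReal_mul, Complex.im_ofReal_mul]
    have h1 : 1 ≤ cutPower 0 1 (t * u.re) := by
      have := le_cutPower (β := 0) (R := 1) (t := t * u.re) (s := 1) le_rfl
      simp only [neg_zero, ENNReal.rpow_zero] at this
      have h' : |t * u.re| ≤ 1 := by
        rw [abs_mul, abs_of_pos ht0]
        nlinarith [Complex.abs_re_le_norm u, abs_nonneg u.re]
      exact this h' h'
    rw [← one_mul (ENNReal.ofReal |u.im| ^ (-a))]
    refine mul_le_mul' h1 (le_cutPower ha ?_ ?_)
    · rw [abs_mul, abs_of_pos ht0]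
      have := Complex.abs_im_le_norm (1 - u)
      simp only [Complex.sub_im, Complex.one_im, zero_sub, abs_neg] at this
      nlinarith [abs_nonneg u.im]
    · rw [abs_mul, abs_of_pos ht0]
      nlinarith [abs_nonneg u.im]
  · have hpow : ENNReal.ofReal (1 - ‖u‖ ^ 2) ^ (-b) =
        ∏ _j : Fin m, ENNReal.ofReal (1 - ‖u‖ ^ 2) ^ (-(b / m)) := by
      rw [Finset.prod_const, Finset.card_univ, Fintype.card_fin, ← ENNReal.rpow_mul_natCast]
      congr 1; field_simp
    rw [hpow]
    refine Finset.prod_le_prod' fun j _ => ?_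
    change _ ≤ cutPower (b / m) (√(2 * η)) (x j.succ).re * cutPower (b / m) (√(2 * η)) (x j.succ).im
    have hre := Complex.abs_re_le_norm (x j.succ)
    have him := Complex.abs_im_le_norm (x j.succ)
    refine le_trans ?_ (mul_le_mul' (le_cutPower hβ0 (hre.trans (hj' j)) le_rfl)
      (le_cutPower hβ0 (him.trans (hj' j)) le_rfl))
    rw [← ENNReal.mul_rpow_of_ne_top ENNReal.ofReal_ne_top ENNReal.ofReal_ne_top,
      ← ENNReal.ofReal_mul (abs_nonneg _)]
    apply ennreal_rpow_neg_anti hβ0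
    apply ENNReal.ofReal_le_ofReal
    refine le_trans ?_ (hj j)
    rw [pow_two]
    gcongr

lemma lintegral_prod_comp {n : ℕ} {c : ℝ≥0} (U : CSpace n ≃ₗᵢ[ℂ] CSpace n)
    (hUv : Measure.map (fun x => (U x).ofLp) (volume : Measure (CSpace n)) =
        c • (volume : Measure (Fin n → ℂ))) {f : Fin n → ℂ → ℝ≥0∞} (hf : ∀ i, Measurable (f i)) :
    ∫⁻ x : CSpace n, ∏ i, f i ((U x).ofLp i) = c * ∏ i, ∫⁻ ζ, f i ζ := by
  have hcont : Continuous fun x => (U x).ofLp :=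
    (EuclideanSpace.equiv (Fin n) ℂ).continuous.comp U.continuous
  rw [← lintegral_map (f := fun y : Fin n → ℂ => ∏ i, f i (y i))
      (Finset.measurable_prod _ fun i _ => (hf i).comp (measurable_pi_apply i)) hcont.measurable,
    hUv, lintegral_smul_measure, lintegral_pi_prod _ hf]
  rfl

lemma toSphere_univ_inv_ne_top (m : ℕ) :
    ((volume : Measure (CSpace (m + 1))).toSphere Set.univ)⁻¹ ≠ ∞ := by
  rw [ENNReal.inv_ne_top, ne_eq, Measure.measure_univ_eq_zero]
  exact Measure.toSphere_ne_zero _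

/-- Integrals over nonisotropic balls of the sphere of a product of powers of `|Im ⟨ξ, e⟩|` and
`1 - |⟨ξ, e⟩|²`. -/
lemma exists_lintegral_cap_le (m : ℕ) (hm : 0 < m) {a b : ℝ} (ha : 0 ≤ a) (ha1 : a < 1)
    (hb0 : 0 ≤ b) (hb : b < m) :
    ∃ C : ℝ≥0, ∀ e : CSpace (m + 1), ‖e‖ = 1 → ∀ η : ℝ, 0 < η →
      ∫⁻ ξ : UnitSphere (m + 1), {ξ : UnitSphere (m + 1) | ‖1 - herm (ξ : CSpace _) e‖ < η}.indicator
        (fun ξ => ENNReal.ofReal |(herm (ξ : CSpace _) e).im| ^ (-a) *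
          ENNReal.ofReal (1 - ‖herm (ξ : CSpace _) e‖ ^ 2) ^ (-b)) ξ ∂(sphereMeasure (m + 1)) ≤
      C * ENNReal.ofReal (η ^ (m + 1 - a - b)) := by
  obtain ⟨c, -, hU⟩ := exists_coordinates m
  have hm' : (0 : ℝ) < m := by exact_mod_cast hm
  set K : ℝ := 4 / (1 - a) * ((2 / (1 - b / m)) ^ 2 * 2 ^ (1 - b / m)) ^ m with hK
  have hK0 : 0 ≤ K := by
    have h0 : 0 < 1 - b / m := by linarith [(div_lt_one hm').2 hb]
    have h0' : 0 < 1 - a := by linarith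
    positivity
  have hT := toSphere_univ_inv_ne_top m
  refine ⟨(((volume : Measure (CSpace (m + 1))).toSphere Set.univ)⁻¹).toNNReal *
    (Module.finrank ℝ (CSpace (m + 1)) * (c * K.toNNReal)), fun e he η hη => ?_⟩
  obtain ⟨U, hUe, hUv⟩ := hU e he
  rw [sphereMeasure, lintegral_smul_measure, smul_eq_mul, ENNReal.coe_mul,
    ENNReal.coe_toNNReal hT, mul_assoc]
  gcongr
  refine (lintegral_toSphere_le _ _
    (fun x => ∏ i, capMajorant m a b η i ((U x).ofLp i)) ?_).trans_eq ?_
  · intro ξ t ht0 ht1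
    by_cases hξ : ‖1 - herm (ξ : CSpace (m + 1)) e‖ < η
    · have hξn : ‖(ξ : CSpace (m + 1))‖ = 1 := by simp
      rw [Set.indicator_apply, if_pos (by exact hξ)]
      refine prod_capMajorant_ge m hm ha hb0 ht0 ht1 ?_ ?_ ?_ hξ
      · rw [← hUe, herm_smul_left]
      · rw [U.norm_map, norm_smul, hξn, Real.norm_eq_abs, abs_of_pos ht0, mul_one]
      · have := norm_herm_le (ξ : CSpace (m + 1)) e
        rwa [hξn, he, mul_one] at this
    · rw [Set.indicator_apply, if_neg (by exact hξ)]
      exact zero_le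
  · rw [lintegral_prod_comp U hUv (measurable_capMajorant m a b η),
      prod_lintegral_capMajorant m hm ha1 hb hη, ← hK, ENNReal.ofReal_mul hK0,
      ENNReal.coe_mul, ENNReal.coe_mul, ENNReal.coe_natCast, mul_assoc, mul_assoc]
    rfl

/-- The point y lies close to the positive real axis of the first coordinate. By the choice of κ,
|Im y_0|² and the transverse squares total at most (2m+1)κ²η = κη/8, so ‖y‖ exceeds Re y_0 by O(κη).
With ‖y‖ > 1/4 this puts y/‖y‖ in the cap of radius η. -/
lemma norm_sub_coord_lt {m : ℕ} (hm : 0 < m) {κ η : ℝ} (hκ0 : 0 < κ)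
    (hκm : 8 * ((2 * m + 1) * κ) = 1) (hη : 0 < η) (hη1 : η ≤ 1) {y : CSpace (m + 1)}
    (h1 : 1 / 4 < (y 0).re) (h2 : (y 0).re < 1 / 2) (h3 : |(y 0).im| < κ * η)
    (h4 : ∀ j : Fin m, ‖y j.succ‖ ^ 2 ≤ 2 * (κ ^ 2 * η)) :
    ‖y‖ < 1 ∧ 1 / 4 < ‖y‖ ∧ ‖(‖y‖ : ℂ) - y 0‖ < η / 4 := by
  have hm' : (1 : ℝ) ≤ m := by exact_mod_cast hm
  have hκ1 : κ ≤ 1 / 24 := by nlinarith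
  have hsum := norm_sq_eq_sum m y
  have hsum' : ∑ j : Fin m, ‖y j.succ‖ ^ 2 ≤ m * (2 * (κ ^ 2 * η)) := by
    refine (Finset.sum_le_card_nsmul _ _ _ fun j _ => h4 j).trans_eq ?_
    simp
  have hy0 : ‖y 0‖ ^ 2 = (y 0).re ^ 2 + (y 0).im ^ 2 := by
    rw [← Complex.normSq_eq_norm_sq, Complex.normSq_apply]; ring
  have him : (y 0).im ^ 2 ≤ κ ^ 2 * η := by
    rw [← sq_abs]
    have : |(y 0).im| ^ 2 ≤ (κ * η) ^ 2 := pow_le_pow_left₀ (abs_nonneg _) h3.le 2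
    nlinarith [mul_nonneg (mul_nonneg (sq_nonneg κ) hη.le) (sub_nonneg.2 hη1)]
  have hnn : 0 ≤ ∑ j : Fin m, ‖y j.succ‖ ^ 2 := Finset.sum_nonneg fun _ _ => by positivity
  have hupper : ‖y‖ ^ 2 ≤ (y 0).re ^ 2 + κ * η / 8 := by
    have : (2 * m + 1) * κ * (κ * η) = 1 / 8 * (κ * η) := by
      rw [show (2 * m + 1) * κ = 1 / 8 by linarith]
    nlinarith
  have hlower : (y 0).re ≤ ‖y‖ := by
    apply le_of_sq_le_sq _ (norm_nonneg y)
    nlinarith [sq_nonneg (y 0).im]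
  have hκη : 0 < κ * η := by positivity
  have hκη1 : κ * η ≤ 1 / 24 * η := by gcongr
  refine ⟨?_, by linarith, ?_⟩
  · nlinarith [norm_nonneg y]
  · have hd : ‖y‖ - (y 0).re ≤ κ * η / 4 := by nlinarith
    refine (Complex.norm_le_abs_re_add_abs_im _).trans_lt ?_
    simp only [Complex.sub_re, Complex.ofReal_re, Complex.sub_im, Complex.ofReal_im, zero_sub,
      abs_neg]
    rw [abs_of_nonneg (by linarith)]
    linarith

/-- Nonisotropic balls of radius `η` of the sphere have measure at least a multiple of `ηⁿ`. -/
lemma exists_le_measure_cap (m : ℕ) (hm : 0 < m) :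
    ∃ c : ℝ≥0, c ≠ 0 ∧ ∀ e : CSpace (m + 1), ‖e‖ = 1 → ∀ η : ℝ, 0 < η → η ≤ 1 →
      c * ENNReal.ofReal (η ^ (m + 1)) ≤
        sphereMeasure (m + 1) {ξ | ‖1 - herm (ξ : CSpace _) e‖ < η} := by
  obtain ⟨c, hc, hU⟩ := exists_coordinates m
  have hm' : (1 : ℝ) ≤ m := by exact_mod_cast hm
  have hT := toSphere_univ_inv_ne_top m
  set κ : ℝ := 1 / (8 * (2 * m + 1)) with hκ
  have hκ0 : 0 < κ := by positivity
  have hκm : 8 * ((2 * m + 1) * κ) = 1 := by rw [hκ]; field_simp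
  have hκ1 : κ ≤ 1 / 24 := by nlinarith
  refine ⟨(((volume : Measure (CSpace (m + 1))).toSphere Set.univ)⁻¹).toNNReal *
    (Module.finrank ℝ (CSpace (m + 1)) *
      (c * (1 / 4 * (2 * κ) * (4 * κ ^ 2) ^ m).toNNReal)), ?_, fun e he η hη hη1 => ?_⟩
  · have h1 : (((volume : Measure (CSpace (m + 1))).toSphere Set.univ)⁻¹).toNNReal ≠ 0 := by
      rw [ENNReal.toNNReal_ne_zero]
      exact ⟨ENNReal.inv_ne_zero.2 (measure_ne_top _ _), hT⟩
    have h2 : (Module.finrank ℝ (CSpace (m + 1)) : ℝ≥0) ≠ 0 := by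
      have : 0 < Module.finrank ℝ (CSpace (m + 1)) := Module.finrank_pos
      exact_mod_cast this.ne'
    have h3 : (1 / 4 * (2 * κ) * (4 * κ ^ 2) ^ m).toNNReal ≠ 0 := by
      rw [ne_eq, Real.toNNReal_eq_zero, not_le]; positivity
    positivity
  obtain ⟨U, hUe, hUv⟩ := hU e he
  have hcap : MeasurableSet {ξ : UnitSphere (m + 1) | ‖1 - herm (ξ : CSpace _) e‖ < η} := by
    apply IsOpen.measurableSet
    exact isOpen_lt (by fun_prop) continuous_const
  rw [sphereMeasure, Measure.smul_apply, smul_eq_mul, ENNReal.coe_mul,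
    ENNReal.coe_toNNReal hT, ENNReal.coe_mul, ENNReal.coe_natCast,
    mul_assoc _ _ (ENNReal.ofReal (η ^ (m + 1))), mul_assoc _ _ (ENNReal.ofReal (η ^ (m + 1))),
    Measure.toSphere_apply' _ hcap]
  refine mul_le_mul' le_rfl (mul_le_mul' le_rfl ?_)
  -- Indicator of a box of size η in Im of the first coordinate and √η in each transverse real
  -- direction: its volume is of order η^{m+1}, and it lies in the cone over the cap.
  let f : Fin (m + 1) → ℂ → ℝ≥0∞ := fun i ζ => Fin.cases (motive := fun _ => ℝ≥0∞)
    ((Set.Ioo (1 / 4 : ℝ) (1 / 2)).indicator 1 ζ.re *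
      (Set.Ioo (-(κ * η)) (κ * η)).indicator 1 ζ.im)
    (fun _ => (Set.Ioo (-(κ * √η)) (κ * √η)).indicator 1 ζ.re *
      (Set.Ioo (-(κ * √η)) (κ * √η)).indicator 1 ζ.im) i
  have hind (p q : ℝ) : Measurable ((Set.Ioo p q).indicator (1 : ℝ → ℝ≥0∞)) :=
    measurable_one.indicator measurableSet_Ioo
  have hf (i) : Measurable (f i) := by
    refine Fin.cases ?_ (fun j => ?_) i
    · exact ((hind _ _).comp Complex.measurable_re).mul ((hind _ _).comp Complex.measurable_im)
    · exact ((hind _ _).comp Complex.measurable_re).mul ((hind _ _).comp Complex.measurable_im)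
  have hI (p q : ℝ) : ∫⁻ t, (Set.Ioo p q).indicator (1 : ℝ → ℝ≥0∞) t = ENNReal.ofReal (q - p) := by
    rw [lintegral_indicator_one measurableSet_Ioo, Real.volume_Ioo]
  have hprod := lintegral_prod_comp U hUv hf
  have hsη : 0 < √η := Real.sqrt_pos.2 hη
  have e0 : ∫⁻ ζ, f 0 ζ = ENNReal.ofReal (1 / 4 * (2 * κ) * η) := by
    refine (lintegral_complex_mul (hind _ _) (hind _ _)).trans ?_
    rw [hI, hI, ← ENNReal.ofReal_mul (by norm_num)]
    congr 1; ring
  have e1 (j : Fin m) : ∫⁻ ζ, f j.succ ζ = ENNReal.ofReal (4 * κ ^ 2 * η) := by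
    refine (lintegral_complex_mul (hind _ _) (hind _ _)).trans ?_
    rw [hI, ← ENNReal.ofReal_mul (by ring_nf; positivity)]
    congr 1
    nlinarith [Real.mul_self_sqrt hη.le]
  rw [Fin.prod_univ_succ, e0, Finset.prod_congr rfl fun j _ => e1 j, Finset.prod_const,
    Finset.card_univ, Fintype.card_fin, ← ENNReal.ofReal_pow (by positivity),
    ← ENNReal.ofReal_mul (by positivity)] at hprod
  have hlhs : ((c * (1 / 4 * (2 * κ) * (4 * κ ^ 2) ^ m).toNNReal : ℝ≥0) : ℝ≥0∞) *
      ENNReal.ofReal (η ^ (m + 1)) = ∫⁻ x, ∏ i, f i ((U x).ofLp i) := by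
    rw [hprod, ENNReal.coe_mul, mul_assoc]
    congr 1
    change ENNReal.ofReal _ * _ = _
    rw [← ENNReal.ofReal_mul (by positivity)]
    congr 1
    rw [mul_pow _ η]; ring
  rw [hlhs]
  refine (lintegral_mono fun x => ?_).trans (lintegral_indicator_one_le _)
  by_cases hx : ∏ i, f i ((U x).ofLp i) = 0
  · rw [hx]; exact zero_le
  have hprod_le : ∏ i, f i ((U x).ofLp i) ≤ 1 := by
    refine Finset.prod_le_one' fun i _ => ?_
    have h1 (p q t : ℝ) : (Set.Ioo p q).indicator (1 : ℝ → ℝ≥0∞) t ≤ 1 :=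
      Set.indicator_le_self' (fun _ _ => zero_le) t
    refine Fin.cases ?_ (fun j => ?_) i
    · exact mul_le_one' (h1 _ _ _) (h1 _ _ _)
    · exact mul_le_one' (h1 _ _ _) (h1 _ _ _)
  have hne (i) : f i ((U x).ofLp i) ≠ 0 := fun h => hx (Finset.prod_eq_zero (Finset.mem_univ i) h)
  have hmem {p q t : ℝ} (h : (Set.Ioo p q).indicator (1 : ℝ → ℝ≥0∞) t ≠ 0) : t ∈ Set.Ioo p q :=
    Set.mem_of_indicator_ne_zero h
  have h0 := mul_ne_zero_iff.1 (hne 0)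
  have hre := hmem h0.1
  have him := hmem h0.2
  have hsucc (j : Fin m) : ‖U x j.succ‖ ^ 2 ≤ 2 * (κ ^ 2 * η) := by
    have h := mul_ne_zero_iff.1 (hne j.succ)
    have h1 := abs_lt.2 (hmem h.1)
    have h2 := abs_lt.2 (hmem h.2)
    rw [← Complex.normSq_eq_norm_sq, Complex.normSq_apply]
    have h3 := mul_self_le_mul_self (abs_nonneg _) h1.le
    have h4 := mul_self_le_mul_self (abs_nonneg _) h2.le
    rw [abs_mul_abs_self] at h3 h4
    have := Real.mul_self_sqrt hη.le
    have h5 : κ * √η * (κ * √η) = κ ^ 2 * η := by rw [← this]; ring_nf; simp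
    linarith
  obtain ⟨hlt, hgt, hsub⟩ := norm_sub_coord_lt hm hκ0 hκm hη hη1 hre.1 hre.2 (abs_lt.2 him) hsucc
  rw [U.norm_map] at hlt hgt hsub
  have hxpos : 0 < ‖x‖ := by linarith
  rw [Set.indicator_of_mem]
  · exact hprod_le
  refine Set.mem_smul.2 ⟨‖x‖, ⟨hxpos, hlt⟩, ‖x‖⁻¹ • x, ⟨⟨‖x‖⁻¹ • x, ?_⟩, ?_, rfl⟩, ?_⟩
  · rw [mem_sphere_zero_iff_norm, norm_smul, norm_inv, norm_norm, inv_mul_cancel₀ hxpos.ne']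
  · change ‖1 - herm (‖x‖⁻¹ • x) e‖ < η
    rw [herm_smul_left, hUe]
    have : (1 : ℂ) - (‖x‖⁻¹ : ℝ) * U x 0 = (‖x‖⁻¹ : ℝ) * (‖x‖ - U x 0) := by
      have : (‖x‖ : ℂ) ≠ 0 := by exact_mod_cast hxpos.ne'
      push_cast; field_simp
    rw [this, norm_mul, Complex.norm_real, norm_inv, norm_norm, inv_mul_lt_iff₀ hxpos]
    nlinarith
  · rw [smul_smul, mul_inv_cancel₀ hxpos.ne', one_smul]

/-! ### The quasi-metric |1 - ⟨x, y⟩| and the region near the singularity -/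

lemma herm_conj {n : ℕ} (x y : CSpace n) : star (herm x y) = herm y x := inner_conj_symm x y

lemma norm_one_sub_herm_comm {n : ℕ} (x y : CSpace n) : ‖1 - herm x y‖ = ‖1 - herm y x‖ := by
  rw [← herm_conj y x, ← norm_star (1 - star _), star_sub, star_star, star_one]

/-- The quasi-triangle inequality for `|1 - ⟨x, y⟩|` on the closed ball. -/
lemma norm_one_sub_herm_lt {n : ℕ} {x y w : CSpace n} (hx : ‖x‖ ≤ 1) (hy : ‖y‖ ≤ 1) (hw : ‖w‖ ≤ 1)
    {η : ℝ} (hxw : ‖1 - herm x w‖ < η) (hyw : ‖1 - herm y w‖ < η) :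
    ‖1 - herm x y‖ < 6 * η := by
  -- The vector ⟨v,w⟩w replaces the projection of v onto w, avoiding division by |w|². The squared
  -- remainder is at most 1-|⟨v,w⟩|² ≤ 2η since |v|, |w| ≤ 1.
  have key {v : CSpace n} (hv : ‖v‖ ≤ 1) (hvw : ‖1 - herm v w‖ < η) :
      ‖v - herm v w • w‖ ^ 2 ≤ 2 * η ∧ ‖herm v w‖ ≤ 1 ∧ 1 - ‖w‖ < η := by
    have h1 := norm_herm_le v w
    have h2 := one_sub_mul_le_norm_one_sub_herm v w
    have h3 : ‖herm v w‖ ≤ 1 := h1.trans (mul_le_one₀ hv (norm_nonneg _) hw)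
    refine ⟨?_, h3, by nlinarith [norm_nonneg w]⟩
    have h4 := @norm_sub_sq ℂ _ _ _ _ v (herm v w • w)
    have h5 : inner ℂ v (herm v w • w) = ((‖herm v w‖ ^ 2 : ℝ) : ℂ) := by
      rw [inner_smul_right]
      change herm v w * herm w v = _
      rw [← herm_conj v w, ← Complex.normSq_eq_norm_sq]
      exact Complex.mul_conj _
    rw [h5, norm_smul, mul_pow] at h4
    have h6 : 1 - ‖herm v w‖ ≤ ‖1 - herm v w‖ := by
      simpa using norm_sub_norm_le (1 : ℂ) (herm v w)
    have h7 : ‖w‖ ^ 2 ≤ 1 := pow_le_one₀ (norm_nonneg _) hw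
    have h8 : ‖v‖ ^ 2 ≤ 1 := pow_le_one₀ (norm_nonneg _) hv
    have h9 : RCLike.re (((‖herm v w‖ ^ 2 : ℝ) : ℂ)) = ‖herm v w‖ ^ 2 := Complex.ofReal_re _
    rw [h9] at h4
    nlinarith [norm_nonneg (herm v w), mul_nonneg (sq_nonneg ‖herm v w‖) (sub_nonneg.2 h7)]
  obtain ⟨a1, a2, a3⟩ := key hx hxw
  obtain ⟨b1, b2, -⟩ := key hy hyw
  have hη : 0 < η := (norm_nonneg _).trans_lt hxw
  set α := herm x w with hα
  set β := herm y w with hβ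
  have hab : ‖herm (x - α • w) (y - β • w)‖ ≤ 2 * η := by
    refine (norm_herm_le _ _).trans ?_
    nlinarith [sq_nonneg (‖x - α • w‖ - ‖y - β • w‖)]
  have hexp : herm x y = herm (x - α • w) (y - β • w) + α * star β * (2 - (‖w‖ ^ 2 : ℝ)) := by
    have hww : inner ℂ w w = ((‖w‖ ^ 2 : ℝ) : ℂ) := by
      rw [inner_self_eq_norm_sq_to_K]; simp
    have e1 : inner ℂ w x = α := rfl
    have e2 : inner ℂ y w = star β := (herm_conj y w).symm
    simp only [herm, inner_sub_left, inner_sub_right, inner_smul_left, inner_smul_right, hww,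
      e1, e2]
    rw [starRingEnd_apply]
    ring
  -- The four terms are bounded by η, η, 2η and 2η, whence the factor 6.
  have e3 : 1 - herm x y = (1 - α) + α * (star (1 - β)) - α * star β * (1 - (‖w‖ ^ 2 : ℝ))
      - herm (x - α • w) (y - β • w) := by
    rw [hexp, star_sub, star_one]; ring
  have e4 : ‖(1 : ℂ) - (‖w‖ ^ 2 : ℝ)‖ ≤ 2 * η := by
    rw [← Complex.ofReal_one, ← Complex.ofReal_sub, Complex.norm_real, Real.norm_eq_abs,
      abs_of_nonneg (by nlinarith [norm_nonneg w])]
    nlinarith [norm_nonneg w]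
  have e5 : ‖α * star (1 - β)‖ < η := by
    rw [norm_mul, norm_star]
    exact lt_of_le_of_lt (mul_le_of_le_one_left (norm_nonneg _) a2) hyw
  have e6 : ‖α * star β * (1 - (‖w‖ ^ 2 : ℝ))‖ ≤ 2 * η := by
    rw [norm_mul, norm_mul, norm_star]
    exact (mul_le_of_le_one_left (norm_nonneg _) (mul_le_one₀ a2 (norm_nonneg _) b2)).trans e4
  rw [e3]
  have t1 := norm_sub_le ((1 - α) + α * (star (1 - β)) - α * star β * (1 - (‖w‖ ^ 2 : ℝ)))
    (herm (x - α • w) (y - β • w))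
  have t2 := norm_sub_le ((1 - α) + α * (star (1 - β))) (α * star β * (1 - (‖w‖ ^ 2 : ℝ)))
  have t3 := norm_add_le (1 - α) (α * (star (1 - β)))
  linarith

lemma herm_ofReal_smul_left {n : ℕ} (r : ℝ) (x w : CSpace n) :
    herm ((r : ℂ) • x) w = r * herm x w := inner_smul_right _ _ _

lemma norm_ofReal_smul_sphere {n : ℕ} {r : ℝ} (hr : 0 ≤ r) (ξ : UnitSphere n) :
    ‖(r : ℂ) • (ξ : CSpace n)‖ = r := by
  rw [norm_smul, Complex.norm_real, Real.norm_eq_abs, abs_of_nonneg hr, norm_eq_of_mem_sphere,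
    mul_one]

/-- Points at bounded invariant distance have comparable distances to the boundary. -/
lemma comparable_of_lt_invRatio {n : ℕ} {r : ℝ} (hr0 : 0 ≤ r) (hr1 : r < 1) (ξ : UnitSphere n)
    {w : CSpace n} (hw : ‖w‖ < 1) (hA : 3 / 4 < invRatio ((r : ℂ) • (ξ : CSpace n)) w) :
    ‖1 - herm ((r : ℂ) • (ξ : CSpace n)) w‖ < 6 * (1 - r) ∧ 1 - ‖w‖ < 6 * (1 - r) ∧
      1 - r < 6 * (1 - ‖w‖) ∧ ‖1 - herm w (ξ : CSpace n)‖ < 7 * (1 - r) := by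
  have hz := norm_ofReal_smul_sphere hr0 ξ
  have hD : 0 < ‖1 - herm ((r : ℂ) • (ξ : CSpace n)) w‖ :=
    norm_one_sub_herm_pos (by rwa [hz]) hw
  have hD1 := one_sub_mul_le_norm_one_sub_herm ((r : ℂ) • (ξ : CSpace n)) w
  rw [invRatio, hz, lt_div_iff₀ (by positivity)] at hA
  rw [hz] at hD1
  set D := ‖1 - herm ((r : ℂ) • (ξ : CSpace n)) w‖ with hDdef
  have hw0 := norm_nonneg w
  have h1 : 1 - r ≤ D := by nlinarith
  have h2 : 1 - ‖w‖ ≤ D := by nlinarith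
  have h3 : (1 - r ^ 2) * (1 - ‖w‖ ^ 2) ≤ 4 * ((1 - r) * (1 - ‖w‖)) := by
    have : (1 + r) * (1 + ‖w‖) ≤ 4 := by nlinarith
    have h4 : 0 ≤ (1 - r) * (1 - ‖w‖) := mul_nonneg (by linarith) (by linarith)
    nlinarith [mul_le_mul_of_nonneg_left this h4]
  -- From 3/4 · D² < 4(1-r)(1-|w|) ≤ 4(1-r)D follows D < (16/3)(1-r).
  have h5 : D < 6 * (1 - r) := by
    have : (1 - r) * (1 - ‖w‖) ≤ (1 - r) * D := mul_le_mul_of_nonneg_left h2 (by linarith)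
    by_contra! hcon
    nlinarith
  refine ⟨h5, h2.trans_lt h5, ?_, ?_⟩
  · have : (1 - r) * (1 - r) ≤ D * D := mul_self_le_mul_self (by linarith) h1
    by_contra! hcon
    nlinarith
  · rw [norm_one_sub_herm_comm]
    have e : 1 - herm (ξ : CSpace n) w =
        (1 - herm ((r : ℂ) • (ξ : CSpace n)) w) - ((1 - r : ℝ) : ℂ) * herm (ξ : CSpace n) w := by
      rw [herm_ofReal_smul_left]; push_cast; ring
    have h6 := norm_sub_le (1 - herm ((r : ℂ) • (ξ : CSpace n)) w)
      (((1 - r : ℝ) : ℂ) * herm (ξ : CSpace n) w)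
    rw [← e, norm_mul, Complex.norm_real, Real.norm_eq_abs, abs_of_pos (by linarith : 0 < 1 - r)]
      at h6
    have h7 := norm_herm_le (ξ : CSpace n) w
    rw [norm_eq_of_mem_sphere, one_mul] at h7
    nlinarith

/-- With u = ⟨ξ,e⟩, the numerator of 1-A is (s - r Re u)² + r²(Im u)² + r²(1-s²)(1-|u|²), so each of
the last two terms alone bounds 1-A from below. The constants come from r² ≥ 1/4, 1-s² ≥ (1-r)/6 and
|1-rsu| < 6(1-r): 12² = 4·36 and 864 = 4·6·36. -/
lemma le_one_sub_invRatio {n : ℕ} {r : ℝ} (hr0 : 1 / 2 ≤ r) (hr1 : r < 1) (ξ : UnitSphere n)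
    {e : CSpace n} (he : ‖e‖ = 1) {s : ℝ} (hs0 : 0 < s) (hs1 : s < 1)
    (hA : 3 / 4 < invRatio ((r : ℂ) • (ξ : CSpace n)) ((s : ℂ) • e)) :
    ‖1 - herm (ξ : CSpace n) e‖ < 12 * (1 - r) ∧
    (|(herm (ξ : CSpace n) e).im| / (12 * (1 - r))) ^ 2 ≤
      1 - invRatio ((r : ℂ) • (ξ : CSpace n)) ((s : ℂ) • e) ∧
    (1 - ‖herm (ξ : CSpace n) e‖ ^ 2) / (864 * (1 - r)) ≤
      1 - invRatio ((r : ℂ) • (ξ : CSpace n)) ((s : ℂ) • e) := by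
  have hz := norm_ofReal_smul_sphere (by linarith) ξ (r := r)
  have hw : ‖(s : ℂ) • e‖ = s := by
    rw [norm_smul, Complex.norm_real, Real.norm_eq_abs, abs_of_pos hs0, he, mul_one]
  have hu : herm ((r : ℂ) • (ξ : CSpace n)) ((s : ℂ) • e) = r * s * herm (ξ : CSpace n) e := by
    rw [herm_ofReal_smul_left, herm, inner_smul_left, Complex.conj_ofReal, herm, mul_assoc]
  have hD : 0 < ‖1 - herm ((r : ℂ) • (ξ : CSpace n)) ((s : ℂ) • e)‖ :=
    norm_one_sub_herm_pos (by rwa [hz]) (by rwa [hw])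
  obtain ⟨c1, c2, c3, -⟩ := comparable_of_lt_invRatio (by linarith) hr1 ξ (by rwa [hw]) hA
  have hu1 : ‖herm (ξ : CSpace n) e‖ ≤ 1 := by
    have := norm_herm_le (ξ : CSpace n) e
    rwa [norm_eq_of_mem_sphere, he, mul_one] at this
  have hD1 := one_sub_mul_le_norm_one_sub_herm ((r : ℂ) • (ξ : CSpace n)) ((s : ℂ) • e)
  rw [hz, hw] at hD1
  rw [hw] at c2 c3
  rw [invRatio, hz, hw]
  rw [hu] at hD hD1 c1 ⊢
  set u := herm (ξ : CSpace n) e with hudef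
  have hδ : 0 < 1 - r := by linarith
  refine ⟨?_, ?_⟩
  · have e1 : 1 - u = (1 - r * s * u) - ((1 - r * s : ℝ) : ℂ) * u := by push_cast; ring
    have h0 : 0 ≤ 1 - r * s := by nlinarith
    have h1 := norm_sub_le (1 - r * s * u) (((1 - r * s : ℝ) : ℂ) * u)
    rw [← e1, norm_mul, Complex.norm_real, Real.norm_eq_abs, abs_of_nonneg h0] at h1
    nlinarith
  have hnum : ‖1 - r * s * u‖ ^ 2 - (1 - r ^ 2) * (1 - s ^ 2) =
      (s - r * u.re) ^ 2 + r ^ 2 * u.im ^ 2 + r ^ 2 * (1 - s ^ 2) * (1 - ‖u‖ ^ 2) := by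
    rw [← Complex.normSq_eq_norm_sq, ← Complex.normSq_eq_norm_sq, Complex.normSq_apply,
      Complex.normSq_apply]
    simp; ring
  set D := ‖1 - r * s * u‖ with hDdef
  have hmain : 1 - (1 - r ^ 2) * (1 - s ^ 2) / D ^ 2 =
      ((s - r * u.re) ^ 2 + r ^ 2 * u.im ^ 2 + r ^ 2 * (1 - s ^ 2) * (1 - ‖u‖ ^ 2)) / D ^ 2 := by
    rw [← hnum]; field_simp
  rw [hmain]
  have hu2 : 0 ≤ 1 - ‖u‖ ^ 2 := by nlinarith [norm_nonneg u]
  have hr2 : 1 / 4 ≤ r ^ 2 := by nlinarith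
  have hs2 : (1 - r) / 6 ≤ 1 - s ^ 2 := by nlinarith
  have hD2 : D ^ 2 ≤ 36 * (1 - r) ^ 2 := by nlinarith
  have hbig : 1 / 4 * u.im ^ 2 ≤ r ^ 2 * u.im ^ 2 := mul_le_mul_of_nonneg_right hr2 (sq_nonneg _)
  have hbig2 : 1 / 4 * ((1 - r) / 6) * (1 - ‖u‖ ^ 2) ≤ r ^ 2 * (1 - s ^ 2) * (1 - ‖u‖ ^ 2) := by
    gcongr
  have hp1 : 0 ≤ 1 / 4 * u.im ^ 2 := by positivity
  have hp2 : 0 ≤ 1 / 4 * ((1 - r) / 6) * (1 - ‖u‖ ^ 2) := by positivity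
  constructor
  · calc (|u.im| / (12 * (1 - r))) ^ 2 = (1 / 4 * u.im ^ 2) / (36 * (1 - r) ^ 2) := by
          rw [div_pow, sq_abs]; field_simp; ring
      _ ≤ (1 / 4 * u.im ^ 2) / D ^ 2 := by gcongr
      _ ≤ _ := by gcongr; nlinarith [sq_nonneg (s - r * u.re)]
  · calc (1 - ‖u‖ ^ 2) / (864 * (1 - r))
        = (1 / 4 * ((1 - r) / 6) * (1 - ‖u‖ ^ 2)) / (36 * (1 - r) ^ 2) := by
          field_simp; ring
      _ ≤ (1 / 4 * ((1 - r) / 6) * (1 - ‖u‖ ^ 2)) / D ^ 2 := by gcongr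
      _ ≤ _ := by gcongr; nlinarith [sq_nonneg (s - r * u.re)]

/-! ### The singular kernel and its integral over the sphere -/

/-- The part of the Green function near its singularity, raised to a power. -/
noncomputable def nearKernel {n : ℕ} (q : ℝ) (z w : CSpace n) : ℝ≥0∞ :=
  if 3 / 4 < invRatio z w then ENNReal.ofReal (1 - invRatio z w) ^ (-q) else 0

/-- The exponent is split as a/2 + b: the power a/2 of 1-A is estimated through |Im u|, the power b
through 1-|u|². This produces the product integrated in `exists_lintegral_cap_le`. -/
lemma nearKernel_le {n : ℕ} {a b : ℝ} (ha : 0 ≤ a) (hb : 0 ≤ b) {r : ℝ} (hr0 : 1 / 2 ≤ r)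
    (hr1 : r < 1) (ξ : UnitSphere n) {e : CSpace n} (he : ‖e‖ = 1) {s : ℝ} (hs0 : 0 < s)
    (hs1 : s < 1) :
    nearKernel (a / 2 + b) ((r : ℂ) • (ξ : CSpace n)) ((s : ℂ) • e) ≤
      ENNReal.ofReal ((12 * (1 - r)) ^ a * (864 * (1 - r)) ^ b) *
      {ξ : UnitSphere n | ‖1 - herm (ξ : CSpace _) e‖ < 12 * (1 - r)}.indicator
        (fun ξ => ENNReal.ofReal |(herm (ξ : CSpace _) e).im| ^ (-a) *
          ENNReal.ofReal (1 - ‖herm (ξ : CSpace _) e‖ ^ 2) ^ (-b)) ξ := by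
  rw [nearKernel]
  split_ifs with hA
  swap
  · exact zero_le
  obtain ⟨h1, h2, h3⟩ := le_one_sub_invRatio hr0 hr1 ξ he hs0 hs1 hA
  rw [Set.indicator_apply, if_pos (by exact h1)]
  set u := herm (ξ : CSpace n) e
  set X := 1 - invRatio ((r : ℂ) • (ξ : CSpace n)) ((s : ℂ) • e)
  have hδ : 0 < 1 - r := by linarith
  have hsplit : ENNReal.ofReal X ^ (-(a / 2 + b)) ≤
      ENNReal.ofReal X ^ (-(a / 2)) * ENNReal.ofReal X ^ (-b) := by
    rcases le_or_gt X 0 with h | h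
    · rw [ENNReal.ofReal_of_nonpos h]
      rcases hb.eq_or_lt with rfl | hb'
      · simp
      · rw [ENNReal.zero_rpow_of_neg (y := -b) (by linarith), ENNReal.mul_top]
        · exact le_top
        · rcases ha.eq_or_lt with rfl | ha'
          · simp
          · rw [ENNReal.zero_rpow_of_neg (by linarith)]; simp
    · rw [← ENNReal.rpow_add _ _ (by simpa using h) ENNReal.ofReal_ne_top]
      apply le_of_eq; congr 1; ring
  have hdiv (t c β : ℝ) (hc : 0 < c) :
      ENNReal.ofReal (t / c) ^ (-β) = ENNReal.ofReal (c ^ β) * ENNReal.ofReal t ^ (-β) := by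
    rw [div_eq_inv_mul, ENNReal.ofReal_mul (by positivity),
      ENNReal.mul_rpow_of_ne_top ENNReal.ofReal_ne_top ENNReal.ofReal_ne_top,
      ENNReal.ofReal_rpow_of_pos (by positivity), Real.inv_rpow hc.le, Real.rpow_neg hc.le, inv_inv]
  have hf1 : ENNReal.ofReal X ^ (-(a / 2)) ≤
      ENNReal.ofReal ((12 * (1 - r)) ^ a) * ENNReal.ofReal |u.im| ^ (-a) := by
    refine (ennreal_rpow_neg_anti (by positivity) (ENNReal.ofReal_le_ofReal h2)).trans_eq ?_
    rw [← hdiv _ _ _ (by positivity), ENNReal.ofReal_pow (by positivity), ← ENNReal.rpow_natCast_mul]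
    congr 1; push_cast; ring
  have hf2 : ENNReal.ofReal X ^ (-b) ≤
      ENNReal.ofReal ((864 * (1 - r)) ^ b) * ENNReal.ofReal (1 - ‖u‖ ^ 2) ^ (-b) := by
    refine (ennreal_rpow_neg_anti hb (ENNReal.ofReal_le_ofReal h3)).trans_eq ?_
    rw [hdiv _ _ _ (by positivity)]
  refine hsplit.trans ((mul_le_mul' hf1 hf2).trans_eq ?_)
  rw [ENNReal.ofReal_mul (by positivity)]
  ring

/-- The integral over the sphere of the singular part of the kernel is controlled by the measure of
a nonisotropic ball. -/
lemma exists_lintegral_nearKernel_le (m : ℕ) (hm : 0 < m) {q : ℝ} (hq : 1 ≤ q)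
    (hqm : q < m + 1 / 2) :
    ∃ C : ℝ≥0, ∀ r : ℝ, 1 - 1 / 36 ≤ r → r < 1 → ∀ w : CSpace (m + 1), ‖w‖ < 1 →
      ∫⁻ ξ : UnitSphere (m + 1), nearKernel q ((r : ℂ) • (ξ : CSpace (m + 1))) w
          ∂(sphereMeasure (m + 1)) ≤
        C * sphereMeasure (m + 1) {ξ | ‖1 - herm w (ξ : CSpace _)‖ < 42 * (1 - r)} := by
  have hm' : (1 : ℝ) ≤ m := by exact_mod_cast hm
  -- The choice leaves a = 1-2ε < 1 and b = q-1/2+ε < m, the two integrability conditions; the room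
  -- for ε > 0 is exactly q < m + 1/2. The cap 1/2 keeps a ≥ 0.
  set ε : ℝ := min ((m + 1 / 2 - q) / 2) (1 / 2) with hε
  have hε0 : 0 < ε := lt_min (by linarith) (by norm_num)
  have hε1 : ε ≤ 1 / 2 := min_le_right _ _
  have hε2 : ε ≤ (m + 1 / 2 - q) / 2 := min_le_left _ _
  set a : ℝ := 1 - 2 * ε with ha
  set b : ℝ := q - 1 / 2 + ε with hb
  have hab : a / 2 + b = q := by rw [ha, hb]; ring
  have ha0 : 0 ≤ a := by linarith
  have hb0 : 0 ≤ b := by linarith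
  obtain ⟨C, hC⟩ := exists_lintegral_cap_le m hm ha0 (by linarith : a < 1) hb0 (by linarith)
  obtain ⟨c, hc0, hc⟩ := exists_le_measure_cap m hm
  refine ⟨C * ((12 : ℝ) ^ a * 864 ^ b * 12 ^ (m + 1 - a - b)).toNNReal * c⁻¹,
    fun r hr hr1 w hw => ?_⟩
  have hδ : 0 < 1 - r := by linarith
  -- If the kernel is not identically zero then 1-|w| < 6(1-r) ≤ 1/6, so w ≠ 0 and e = w/|w| makes
  -- sense.
  by_cases hex : ∃ ξ : UnitSphere (m + 1), 3 / 4 < invRatio ((r : ℂ) • (ξ : CSpace (m + 1))) w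
  swap
  · push Not at hex
    have : ∀ ξ : UnitSphere (m + 1), nearKernel q ((r : ℂ) • (ξ : CSpace (m + 1))) w = 0 :=
      fun ξ => if_neg (not_lt.2 (hex ξ))
    simp_rw [this]
    rw [lintegral_zero]
    exact zero_le
  obtain ⟨ξ₀, hξ₀⟩ := hex
  obtain ⟨-, hws, -, -⟩ := comparable_of_lt_invRatio (by linarith) hr1 ξ₀ hw hξ₀
  have hs0 : 0 < ‖w‖ := by linarith
  set e : CSpace (m + 1) := ((‖w‖⁻¹ : ℝ) : ℂ) • w with he
  have he1 : ‖e‖ = 1 := by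
    rw [he, norm_smul, Complex.norm_real, norm_inv, norm_norm, inv_mul_cancel₀ hs0.ne']
  have hwe : w = (‖w‖ : ℂ) • e := by
    rw [he, smul_smul, ← Complex.ofReal_mul, mul_inv_cancel₀ hs0.ne', Complex.ofReal_one, one_smul]
  -- The cap of radius 36(1-r) about e is contained in the set on the right, as 1-|w| < 6(1-r) and
  -- 36+6 = 42. The bound r ≥ 1-1/36 keeps this radius at most 1.
  have hlow : (c : ℝ≥0∞) * ENNReal.ofReal ((1 - r) ^ (m + 1)) ≤
      sphereMeasure (m + 1) {ξ | ‖1 - herm w (ξ : CSpace _)‖ < 42 * (1 - r)} := by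
    calc (c : ℝ≥0∞) * ENNReal.ofReal ((1 - r) ^ (m + 1))
        ≤ c * ENNReal.ofReal ((36 * (1 - r)) ^ (m + 1)) := by
          gcongr; linarith
      _ ≤ _ := hc e he1 (36 * (1 - r)) (by linarith) (by linarith)
      _ ≤ _ := by
          apply measure_mono
          intro ξ hξ
          have hξ' : ‖1 - herm (ξ : CSpace (m + 1)) e‖ < 36 * (1 - r) := hξ
          change ‖1 - herm w (ξ : CSpace (m + 1))‖ < 42 * (1 - r)
          have e1 : 1 - herm w (ξ : CSpace (m + 1)) = ((1 - ‖w‖ : ℝ) : ℂ) +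
              ‖w‖ * (1 - herm e (ξ : CSpace (m + 1))) := by
            conv_lhs => rw [hwe, herm_ofReal_smul_left]
            push_cast; ring
          rw [e1]
          refine (norm_add_le _ _).trans_lt ?_
          rw [norm_mul, Complex.norm_real, Complex.norm_real, norm_norm, Real.norm_eq_abs,
            abs_of_pos (by linarith), norm_one_sub_herm_comm e]
          nlinarith [norm_nonneg (1 - herm (ξ : CSpace (m + 1)) e)]
  calc _ ≤ ∫⁻ ξ : UnitSphere (m + 1), ENNReal.ofReal ((12 * (1 - r)) ^ a * (864 * (1 - r)) ^ b) *
      {ξ : UnitSphere (m + 1) | ‖1 - herm (ξ : CSpace _) e‖ < 12 * (1 - r)}.indicator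
        (fun ξ => ENNReal.ofReal |(herm (ξ : CSpace _) e).im| ^ (-a) *
          ENNReal.ofReal (1 - ‖herm (ξ : CSpace _) e‖ ^ 2) ^ (-b)) ξ ∂(sphereMeasure (m + 1)) := by
        refine lintegral_mono fun ξ => ?_
        have := nearKernel_le ha0 hb0 (by linarith) hr1 ξ he1 hs0 hw
        rwa [hab, ← hwe] at this
    _ ≤ ENNReal.ofReal ((12 * (1 - r)) ^ a * (864 * (1 - r)) ^ b) *
        (C * ENNReal.ofReal ((12 * (1 - r)) ^ (m + 1 - a - b))) := by
        rw [lintegral_const_mul' _ _ ENNReal.ofReal_ne_top]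
        exact mul_le_mul' le_rfl (hC e he1 _ (by linarith))
    _ = ((C * ((12 : ℝ) ^ a * 864 ^ b * 12 ^ (m + 1 - a - b)).toNNReal * c⁻¹ : ℝ≥0) : ℝ≥0∞) *
        (c * ENNReal.ofReal ((1 - r) ^ (m + 1))) := by
        have e1 : ENNReal.ofReal ((12 * (1 - r)) ^ a * (864 * (1 - r)) ^ b) *
            ENNReal.ofReal ((12 * (1 - r)) ^ (m + 1 - a - b)) =
            ENNReal.ofReal ((12 : ℝ) ^ a * 864 ^ b * 12 ^ (m + 1 - a - b)) *
              ENNReal.ofReal ((1 - r) ^ (m + 1)) := by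
          rw [← ENNReal.ofReal_mul (by positivity), ← ENNReal.ofReal_mul (by positivity)]
          congr 1
          have e2 : (1 - r) ^ (m + 1) = (1 - r) ^ a * (1 - r) ^ b * (1 - r) ^ (m + 1 - a - b) := by
            rw [← Real.rpow_add hδ, ← Real.rpow_add hδ, ← Real.rpow_natCast]
            congr 1; push_cast; ring
          rw [e2, Real.mul_rpow (by norm_num) hδ.le, Real.mul_rpow (by norm_num) hδ.le,
            Real.mul_rpow (by norm_num) hδ.le]
          ring
        have e3 : ((c⁻¹ : ℝ≥0) : ℝ≥0∞) * c = 1 := by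
          rw [← ENNReal.coe_mul, inv_mul_cancel₀ hc0, ENNReal.coe_one]
        rw [mul_left_comm, e1, ENNReal.coe_mul, ENNReal.coe_mul]
        calc _ = C * (ENNReal.ofReal ((12 : ℝ) ^ a * 864 ^ b * 12 ^ (m + 1 - a - b)) *
              ENNReal.ofReal ((1 - r) ^ (m + 1))) * (((c⁻¹ : ℝ≥0) : ℝ≥0∞) * c) := by
              rw [e3, mul_one]
          _ = _ := by rw [ENNReal.ofReal]; ring
    _ ≤ _ := by gcongr

/-! ### Jensen's inequality -/

/-- Jensen's inequality for powers of lower Lebesgue integrals. -/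
lemma lintegral_rpow_le {X : Type*} [MeasurableSpace X] (ν : Measure X) {p : ℝ} (hp : 1 < p)
    {f : X → ℝ≥0∞} (hf : Measurable f) :
    (∫⁻ x, f x ∂ν) ^ p ≤ ν Set.univ ^ (p - 1) * ∫⁻ x, f x ^ p ∂ν := by
  have hpq := Real.HolderConjugate.conjExponent hp
  have h := ENNReal.lintegral_mul_le_Lp_mul_Lq ν hpq hf.aemeasurable
    (measurable_one (α := ℝ≥0∞)).aemeasurable
  simp only [Pi.mul_apply, Pi.one_apply, mul_one, ENNReal.one_rpow, lintegral_one] at h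
  have hp0 : 0 < p := by linarith
  refine (ENNReal.rpow_le_rpow h hp0.le).trans_eq ?_
  rw [ENNReal.mul_rpow_of_nonneg _ _ hp0.le, ← ENNReal.rpow_mul, ← ENNReal.rpow_mul,
    one_div_mul_cancel hp0.ne', ENNReal.rpow_one, mul_comm]
  congr 2
  rw [Real.conjExponent]; field_simp

/-- Jensen for the discrete measure with mass a k at k, followed by termwise integration; it plays
the role of Minkowski's inequality for infinite sums. -/
lemma lintegral_tsum_rpow_le {X : Type*} [MeasurableSpace X] (ν : Measure X) {p : ℝ} (hp : 1 < p)
    (a : ℕ → ℝ≥0∞) {g : ℕ → X → ℝ≥0∞} (hg : ∀ k, Measurable (g k)) {B : ℝ≥0∞}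
    (hB : ∀ k, ∫⁻ x, g k x ^ p ∂ν ≤ B) :
    ∫⁻ x, (∑' k, a k * g k x) ^ p ∂ν ≤ (∑' k, a k) ^ p * B := by
  have key (x : X) : (∑' k, a k * g k x) ^ p ≤ (∑' k, a k) ^ (p - 1) * ∑' k, a k * g k x ^ p := by
    have h := lintegral_rpow_le (Measure.sum fun k => a k • Measure.dirac k) hp
      (f := fun k => g k x) (measurable_of_countable _)
    simpa [lintegral_sum_measure, lintegral_smul_measure] using h
  refine (lintegral_mono key).trans ?_
  have hm (k : ℕ) : Measurable fun x => a k * g k x ^ p :=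
    ((hg k).pow_const p).const_mul _
  rw [lintegral_const_mul _ (Measurable.tsum hm), lintegral_tsum fun k => (hm k).aemeasurable]
  have e : (∑' k, a k) ^ p = (∑' k, a k) ^ (p - 1) * ∑' k, a k := by
    conv_rhs => rw [← ENNReal.rpow_one (∑' k, a k), ← ENNReal.rpow_mul, one_mul]
    rw [← ENNReal.rpow_add_of_nonneg _ _ (by linarith) zero_le_one, sub_add_cancel]
  rw [e, mul_assoc, ← ENNReal.tsum_mul_right]
  gcongr with k
  rw [lintegral_const_mul _ ((hg k).pow_const p)]
  gcongr
  exact hB k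

/-! ### The weighted measure and measurability -/

section weighted

variable {n : ℕ} (μ : Measure (UnitBall n))

lemma norm_lt_one_of_ball (w : UnitBall n) : ‖(w : CSpace n)‖ < 1 := by
  exact mem_ball_zero_iff.1 w.2

lemma lintegral_weightedMeasure {f : UnitBall n → ℝ≥0∞} (hf : Measurable f) :
    ∫⁻ w, f w ∂(weightedMeasure μ) =
      ∫⁻ w, ENNReal.ofReal ((1 - ‖(w : CSpace n)‖) ^ n) * f w ∂μ := by
  rw [weightedMeasure, lintegral_withDensity_eq_lintegral_mul _ (by fun_prop) hf]
  rfl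

lemma isFiniteMeasure_weightedMeasure
    (hμ : ∫⁻ w, ENNReal.ofReal ((1 - ‖(w : CSpace n)‖ ^ 2) ^ n) ∂μ < ∞) :
    IsFiniteMeasure (weightedMeasure μ) := by
  constructor
  rw [weightedMeasure, withDensity_apply _ MeasurableSet.univ, setLIntegral_univ]
  refine (lintegral_mono fun w => ?_).trans_lt hμ
  have hw := norm_lt_one_of_ball w
  have hw0 := norm_nonneg (w : CSpace n)
  apply ENNReal.ofReal_le_ofReal
  apply pow_le_pow_left₀ <;> nlinarith

lemma measurableSet_anisoCap (ξ : UnitSphere n) (δ : ℝ) : MeasurableSet (anisoCap ξ δ) := by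
  apply IsOpen.measurableSet
  exact isOpen_lt (by fun_prop) continuous_const

lemma measurable_measure_anisoCap (ν : Measure (UnitBall n)) [IsFiniteMeasure ν] (δ : ℝ) :
    Measurable fun ξ : UnitSphere n => ν (anisoCap ξ δ) := by
  have : MeasurableSet {q : UnitSphere n × UnitBall n |
      ‖1 - herm (q.2 : CSpace n) (q.1 : CSpace n)‖ < δ} := by
    apply IsOpen.measurableSet
    exact isOpen_lt (by fun_prop) continuous_const
  exact measurable_measure_prodMk_left this

lemma measurable_measure_ballCap (ν : Measure (UnitBall n)) [IsFiniteMeasure ν] (δ : ℝ) :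
    Measurable fun w : UnitBall n =>
      ν {v | ‖1 - herm (v : CSpace n) (w : CSpace n)‖ < δ} := by
  have : MeasurableSet {q : UnitBall n × UnitBall n |
      ‖1 - herm (q.2 : CSpace n) (q.1 : CSpace n)‖ < δ} := by
    apply IsOpen.measurableSet
    exact isOpen_lt (by fun_prop) continuous_const
  exact measurable_measure_prodMk_left this

lemma measurable_invRatio (r : ℝ) : Measurable fun q : UnitSphere n × UnitBall n =>
    invRatio ((r : ℂ) • (q.1 : CSpace n)) (q.2 : CSpace n) := by
  unfold invRatio
  apply Measurable.div
  · exact Continuous.measurable (by fun_prop)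
  · exact Continuous.measurable (by fun_prop)

lemma measurable_nearKernel (s r : ℝ) : Measurable fun q : UnitSphere n × UnitBall n =>
    nearKernel s ((r : ℂ) • (q.1 : CSpace n)) (q.2 : CSpace n) := by
  unfold nearKernel
  have := measurable_invRatio (n := n) r
  exact Measurable.ite (measurableSet_lt measurable_const this)
    ((measurable_const.sub this).ennreal_ofReal.pow_const _) measurable_const

lemma nearKernel_rpow {p : ℝ} (hp : 0 < p) (s : ℝ) (z w : CSpace n) :
    nearKernel s z w ^ p = nearKernel (s * p) z w := by
  unfold nearKernel
  split_ifs
  · rw [← ENNReal.rpow_mul, neg_mul]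
  · exact ENNReal.zero_rpow_of_pos hp

end weighted

/-! ### From means to caps -/

/-- With z = (1-δ)ξ, on the cap |1-⟨z,w⟩| ≤ 2δ and 1-|z|² ≥ δ, so 1-|w| ≤ 4δA. Raise this to the
power n and apply the lower bound for G. -/
lemma exists_weightedMeasure_le_greenPotential (n : ℕ) (hn : 1 < n) :
    ∃ K : ℝ≥0, ∀ (μ : Measure (UnitBall n)) (ξ : UnitSphere n) (δ : ℝ), 0 < δ → δ < 1 →
      weightedMeasure μ (anisoCap ξ δ) ≤ (K * ENNReal.ofReal (δ ^ n)) *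
        greenPotential μ (((1 - δ : ℝ) : ℂ) • (ξ : CSpace n)) := by
  obtain ⟨c, hc, h⟩ := exists_le_green n hn
  refine ⟨(4 ^ n / c).toNNReal, fun μ ξ δ hδ hδ1 => ?_⟩
  have hz := norm_ofReal_smul_sphere (by linarith : 0 ≤ 1 - δ) ξ
  rw [weightedMeasure, withDensity_apply _ (measurableSet_anisoCap ξ δ), greenPotential,
    ← lintegral_const_mul' _ _ (ENNReal.mul_ne_top ENNReal.coe_ne_top ENNReal.ofReal_ne_top)]
  refine (setLIntegral_mono' (measurableSet_anisoCap ξ δ) fun w hw => ?_).trans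
    (setLIntegral_le_lintegral _ _)
  have hw1 := norm_lt_one_of_ball w
  have hw0 := norm_nonneg (w : CSpace n)
  have hw' : ‖1 - herm (w : CSpace n) (ξ : CSpace n)‖ < δ := hw
  refine le_trans ?_ (mul_le_mul' le_rfl (h _ _ (by rw [hz]; linarith) hw1))
  change _ ≤ ENNReal.ofReal _ * _ * _
  rw [← ENNReal.ofReal_mul (by positivity), ← ENNReal.ofReal_mul (by positivity)]
  apply ENNReal.ofReal_le_ofReal
  have e : 4 ^ n / c * δ ^ n * (c * invRatio (((1 - δ : ℝ) : ℂ) • (ξ : CSpace n)) w ^ n) =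
      (4 * δ * invRatio (((1 - δ : ℝ) : ℂ) • (ξ : CSpace n)) w) ^ n := by
    rw [mul_pow, mul_pow]; field_simp
  rw [e]
  apply pow_le_pow_left₀ (by linarith)
  have hD0 := norm_one_sub_herm_pos (z := ((1 - δ : ℝ) : ℂ) • (ξ : CSpace n)) (w := (w : CSpace n))
    (by rw [hz]; linarith) hw1
  have hD : ‖1 - herm (((1 - δ : ℝ) : ℂ) • (ξ : CSpace n)) (w : CSpace n)‖ ≤ 2 * δ := by
    rw [norm_one_sub_herm_comm] at hw'
    have e1 : 1 - herm (((1 - δ : ℝ) : ℂ) • (ξ : CSpace n)) (w : CSpace n) =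
        (1 - herm (ξ : CSpace n) (w : CSpace n)) + (δ : ℂ) * herm (ξ : CSpace n) (w : CSpace n) := by
      rw [herm_ofReal_smul_left]; push_cast; ring
    rw [e1]
    refine (norm_add_le _ _).trans ?_
    rw [norm_mul, Complex.norm_real, Real.norm_eq_abs, abs_of_pos hδ]
    have h7 := norm_herm_le (ξ : CSpace n) (w : CSpace n)
    rw [norm_eq_of_mem_sphere, one_mul] at h7
    nlinarith
  rw [invRatio, hz, mul_div_assoc', le_div_iff₀ (by positivity)]
  set D := ‖1 - herm (((1 - δ : ℝ) : ℂ) • (ξ : CSpace n)) (w : CSpace n)‖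
  have h1 : D ^ 2 ≤ 4 * δ * δ := by nlinarith
  have h2 : δ * (1 - ‖(w : CSpace n)‖) ≤
      (1 - (1 - δ) ^ 2) * (1 - ‖(w : CSpace n)‖ ^ 2) := by
    apply mul_le_mul <;> nlinarith
  calc (1 - ‖(w : CSpace n)‖) * D ^ 2 ≤ (1 - ‖(w : CSpace n)‖) * (4 * δ * δ) :=
        mul_le_mul_of_nonneg_left h1 (by linarith)
    _ = 4 * δ * (δ * (1 - ‖(w : CSpace n)‖)) := by ring
    _ ≤ _ := by gcongr

lemma lintegral_const_mul_rpow_rpow {X : Type*} [MeasurableSpace X] (ν : Measure X) {p : ℝ}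
    (hp : 0 < p) {a : ℝ≥0∞} (ha : a ≠ ∞) (f : X → ℝ≥0∞) :
    (∫⁻ x, (a * f x) ^ p ∂ν) ^ (1 / p) = a * (∫⁻ x, f x ^ p ∂ν) ^ (1 / p) := by
  simp_rw [ENNReal.mul_rpow_of_nonneg _ _ hp.le]
  rw [lintegral_const_mul' _ _ (ENNReal.rpow_ne_top_of_nonneg hp.le ha),
    ENNReal.mul_rpow_of_nonneg _ _ (by positivity), ← ENNReal.rpow_mul, mul_one_div_cancel hp.ne',
    ENNReal.rpow_one]

lemma lintegral_anisoCap_le {n : ℕ} [NeZero n] {p : ℝ} (hp : 0 < p) (ν : Measure (UnitBall n))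
    (δ : ℝ) :
    (∫⁻ ξ : UnitSphere n, ν (anisoCap ξ δ) ^ p ∂(sphereMeasure n)) ^ (1 / p) ≤ ν Set.univ := by
  calc _ ≤ (∫⁻ _ξ : UnitSphere n, ν Set.univ ^ p ∂(sphereMeasure n)) ^ (1 / p) := by
        gcongr; exact Set.subset_univ _
    _ = _ := by
        rw [lintegral_const, measure_univ (μ := sphereMeasure n), mul_one, ← ENNReal.rpow_mul, mul_one_div_cancel hp.ne',
          ENNReal.rpow_one]

/-- The estimate on nonisotropic balls follows from the growth of the means of the potential. -/
lemma caps_of_means {n : ℕ} (hn : 1 < n) {p γ : ℝ} (hp : 1 < p) (hγ : 0 ≤ γ)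
    (μ : Measure (UnitBall n)) [IsFiniteMeasure (weightedMeasure μ)]
    (h : ∃ c : ℝ≥0, ∀ᶠ r in 𝓝[<] (1 : ℝ), sphereMean p r (greenPotential μ) ≤
          (c : ℝ≥0∞) * ENNReal.ofReal ((1 - r) ^ (γ - (n : ℝ)))) :
    ∃ c : ℝ≥0, ∀ δ : ℝ, 0 < δ → δ < 1 →
        (∫⁻ ξ : UnitSphere n, weightedMeasure μ (anisoCap ξ δ) ^ p ∂(sphereMeasure n)) ^ (1 / p) ≤
          (c : ℝ≥0∞) * ENNReal.ofReal (δ ^ γ) := by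
  have : NeZero n := ⟨by omega⟩
  have hp0 : 0 < p := by linarith
  obtain ⟨c, hc⟩ := h
  obtain ⟨K, hK⟩ := exists_weightedMeasure_le_greenPotential n hn
  obtain ⟨r₀, hr₀, hr⟩ := (mem_nhdsLT_iff_exists_Ioo_subset).1 hc
  have hr₀' : r₀ < 1 := hr₀
  -- The second summand serves δ ≥ 1-r₀, where the growth hypothesis says nothing: there the total
  -- mass bounds the left side and (δ/(1-r₀))^γ ≥ 1.
  refine ⟨K * c + (weightedMeasure μ Set.univ).toNNReal * (((1 - r₀) ^ γ)⁻¹).toNNReal,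
    fun δ hδ hδ1 => ?_⟩
  rw [ENNReal.coe_add, add_mul]
  by_cases hδr : δ < 1 - r₀
  · refine le_trans ?_ (self_le_add_right _ _)
    have hmean := hr (show 1 - δ ∈ Set.Ioo r₀ 1 from ⟨by linarith, by linarith⟩)
    simp only [Set.mem_ofPred_eq, sub_sub_cancel] at hmean
    calc _ ≤ (∫⁻ ξ : UnitSphere n, ((K * ENNReal.ofReal (δ ^ n)) *
          greenPotential μ (((1 - δ : ℝ) : ℂ) • (ξ : CSpace n))) ^ p
            ∂(sphereMeasure n)) ^ (1 / p) := by
          gcongr with ξ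
          exact hK μ ξ δ hδ hδ1
      _ = (K * ENNReal.ofReal (δ ^ n)) * sphereMean p (1 - δ) (greenPotential μ) :=
          lintegral_const_mul_rpow_rpow _ hp0
            (ENNReal.mul_ne_top ENNReal.coe_ne_top ENNReal.ofReal_ne_top) _
      _ ≤ (K * ENNReal.ofReal (δ ^ n)) * (c * ENNReal.ofReal (δ ^ (γ - (n : ℝ)))) := by gcongr
      _ = _ := by
          rw [mul_mul_mul_comm, ← ENNReal.ofReal_mul (by positivity), ENNReal.coe_mul,
            ← Real.rpow_natCast, ← Real.rpow_add hδ]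
          congr 3; ring
  · refine le_trans ?_ (self_le_add_left _ _)
    refine (lintegral_anisoCap_le hp0 _ _).trans ?_
    have h1 : 0 < 1 - r₀ := by linarith
    rw [ENNReal.coe_mul, ENNReal.coe_toNNReal (measure_ne_top _ _), mul_assoc]
    apply le_mul_of_one_le_right zero_le
    change 1 ≤ ENNReal.ofReal _ * _
    rw [← ENNReal.ofReal_mul (by positivity), ENNReal.one_le_ofReal, ← div_eq_inv_mul,
      one_le_div (by positivity)]
    exact Real.rpow_le_rpow h1.le (by linarith) hγ

/-! ### From caps to means: splitting the potential -/

lemma one_sub_le_norm_one_sub_herm {n : ℕ} {r : ℝ} (hr0 : 0 ≤ r) (ξ : UnitSphere n)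
    (w : UnitBall n) : 1 - r ≤ ‖1 - herm ((r : ℂ) • (ξ : CSpace n)) (w : CSpace n)‖ := by
  have h := one_sub_mul_le_norm_one_sub_herm ((r : ℂ) • (ξ : CSpace n)) (w : CSpace n)
  rw [norm_ofReal_smul_sphere hr0] at h
  nlinarith [norm_lt_one_of_ball w]

lemma invRatio_pow_le {n : ℕ} {r : ℝ} (hr0 : 0 ≤ r) (hr1 : r < 1) (ξ : UnitSphere n)
    (w : UnitBall n) :
    invRatio ((r : ℂ) • (ξ : CSpace n)) (w : CSpace n) ^ n ≤ (1 - ‖(w : CSpace n)‖) ^ n *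
      (4 ^ n * ((1 - r) / ‖1 - herm ((r : ℂ) • (ξ : CSpace n)) (w : CSpace n)‖ ^ 2) ^ n) := by
  have hw := norm_lt_one_of_ball w
  have hw0 := norm_nonneg (w : CSpace n)
  have hz := norm_ofReal_smul_sphere hr0 ξ
  have hA := (invRatio_pos (z := (r : ℂ) • (ξ : CSpace n)) (by rwa [hz]) hw).le
  have hD := norm_one_sub_herm_pos (z := (r : ℂ) • (ξ : CSpace n)) (by rwa [hz]) hw
  rw [← mul_pow, ← mul_pow]
  apply pow_le_pow_left₀ hA
  have : (1 + r) * (1 + ‖(w : CSpace n)‖) ≤ 4 := by nlinarith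
  have h4 : 0 ≤ (1 - r) * (1 - ‖(w : CSpace n)‖) := mul_nonneg (by linarith) (by linarith)
  have h5 : (1 - r ^ 2) * (1 - ‖(w : CSpace n)‖ ^ 2) ≤ (1 - ‖(w : CSpace n)‖) * (4 * (1 - r)) := by
    nlinarith [mul_le_mul_of_nonneg_left this h4]
  rw [invRatio, hz, mul_div_assoc', mul_div_assoc']
  exact div_le_div_of_nonneg_right h5 (sq_nonneg _)

/-- The singular term carries no factor (1-|w|)ⁿ, but where it is nonzero 1-r < 6(1-|w|), so the
weight can be inserted at the cost of 6ⁿ(1-r)^{-n}. -/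
lemma exists_green_le_weighted (n : ℕ) (hn : 1 < n) :
    ∃ C : ℝ≥0, ∀ r : ℝ, 0 ≤ r → r < 1 → ∀ (ξ : UnitSphere n) (w : UnitBall n),
      green ((r : ℂ) • (ξ : CSpace n)) (w : CSpace n) ≤ C *
        (ENNReal.ofReal ((1 - ‖(w : CSpace n)‖) ^ n) * ENNReal.ofReal
            (((1 - r) / ‖1 - herm ((r : ℂ) • (ξ : CSpace n)) (w : CSpace n)‖ ^ 2) ^ n) +
          ENNReal.ofReal (((1 - r) ^ n)⁻¹) * (ENNReal.ofReal ((1 - ‖(w : CSpace n)‖) ^ n) *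
            nearKernel ((n : ℝ) - 1) ((r : ℂ) • (ξ : CSpace n)) (w : CSpace n))) := by
  obtain ⟨C, hC⟩ := exists_green_le n hn
  refine ⟨C * ((6 : ℝ) ^ n).toNNReal, fun r hr0 hr1 ξ w => ?_⟩
  have hδ : 0 < 1 - r := by linarith
  have hz := norm_ofReal_smul_sphere hr0 ξ
  have hw := norm_lt_one_of_ball w
  have hw1 : 0 ≤ 1 - ‖(w : CSpace n)‖ := by linarith
  refine (hC _ _ (by rwa [hz]) hw).trans ?_
  rw [ENNReal.coe_mul, mul_assoc]
  refine mul_le_mul' (le_refl (C : ℝ≥0∞)) ?_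
  rw [mul_add]
  refine add_le_add ?_ ?_
  · change _ ≤ ENNReal.ofReal _ * _
    rw [← ENNReal.ofReal_mul (by positivity), ← ENNReal.ofReal_mul (by positivity)]
    apply ENNReal.ofReal_le_ofReal
    refine (invRatio_pow_le hr0 hr1 ξ w).trans ?_
    rw [mul_left_comm]
    apply mul_le_mul_of_nonneg_right _ (by positivity)
    exact pow_le_pow_left₀ (by norm_num) (by norm_num) n
  · change nearKernel ((n : ℝ) - 1) ((r : ℂ) • (ξ : CSpace n)) (w : CSpace n) ≤ ENNReal.ofReal _ * _
    by_cases hA : 3 / 4 < invRatio ((r : ℂ) • (ξ : CSpace n)) (w : CSpace n)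
    · obtain ⟨-, -, h3, -⟩ := comparable_of_lt_invRatio hr0 hr1 ξ hw hA
      rw [← mul_assoc, ← mul_assoc, ← ENNReal.ofReal_mul (by positivity),
        ← ENNReal.ofReal_mul (by positivity)]
      apply le_mul_of_one_le_left zero_le
      rw [ENNReal.one_le_ofReal, mul_right_comm, ← mul_pow, ← div_eq_mul_inv,
        one_le_div (by positivity)]
      exact pow_le_pow_left₀ hδ.le h3.le n
    · rw [nearKernel, if_neg hA]; exact zero_le

lemma measurable_nearKernel_right {n : ℕ} (s r : ℝ) (ξ : UnitSphere n) :
    Measurable fun w : UnitBall n => nearKernel s ((r : ℂ) • (ξ : CSpace n)) (w : CSpace n) := by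
  have := (measurable_nearKernel s r).comp (measurable_prodMk_left (x := ξ))
  exact this

/-- The potential is controlled by a Poisson type integral and a local singular integral with
respect to the weighted measure. -/
lemma exists_greenPotential_le (n : ℕ) (hn : 1 < n) :
    ∃ C : ℝ≥0, ∀ (μ : Measure (UnitBall n)) (r : ℝ), 0 ≤ r → r < 1 → ∀ ξ : UnitSphere n,
      greenPotential μ ((r : ℂ) • (ξ : CSpace n)) ≤ C *
        (∫⁻ w, ENNReal.ofReal
            (((1 - r) / ‖1 - herm ((r : ℂ) • (ξ : CSpace n)) (w : CSpace n)‖ ^ 2) ^ n)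
              ∂(weightedMeasure μ) +
          ENNReal.ofReal (((1 - r) ^ n)⁻¹) *
            ∫⁻ w, nearKernel ((n : ℝ) - 1) ((r : ℂ) • (ξ : CSpace n)) (w : CSpace n)
              ∂(weightedMeasure μ)) := by
  obtain ⟨C, hC⟩ := exists_green_le_weighted n hn
  refine ⟨C, fun μ r hr0 hr1 ξ => ?_⟩
  have hm1 : Measurable fun w : UnitBall n => ENNReal.ofReal
      (((1 - r) / ‖1 - herm ((r : ℂ) • (ξ : CSpace n)) (w : CSpace n)‖ ^ 2) ^ n) := by
    refine ((measurable_const.div ?_).pow_const n).ennreal_ofReal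
    exact Continuous.measurable (by fun_prop)
  have hm2 : Measurable fun w : UnitBall n =>
      nearKernel ((n : ℝ) - 1) ((r : ℂ) • (ξ : CSpace n)) (w : CSpace n) :=
    measurable_nearKernel_right _ r ξ
  have hwt : Measurable fun w : UnitBall n => ENNReal.ofReal ((1 - ‖(w : CSpace n)‖) ^ n) := by
    fun_prop
  have hm3 : Measurable fun w : UnitBall n => ENNReal.ofReal ((1 - ‖(w : CSpace n)‖) ^ n) *
      ENNReal.ofReal
        (((1 - r) / ‖1 - herm ((r : ℂ) • (ξ : CSpace n)) (w : CSpace n)‖ ^ 2) ^ n) := hwt.mul hm1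
  refine (lintegral_mono fun w => hC r hr0 hr1 ξ w).trans_eq ?_
  rw [lintegral_const_mul' _ _ ENNReal.coe_ne_top, lintegral_weightedMeasure μ hm1,
    lintegral_weightedMeasure μ hm2, lintegral_add_left hm3,
    lintegral_const_mul' _ _ ENNReal.ofReal_ne_top]

/-! ### The Poisson type part -/

/-- Dyadic decomposition of the Poisson type kernel. -/
lemma poissonKernel_le_tsum {n : ℕ} {r : ℝ} (hr0 : 0 ≤ r) (hr1 : r < 1) (ξ : UnitSphere n)
    (w : UnitBall n) :
    ENNReal.ofReal (((1 - r) / ‖1 - herm ((r : ℂ) • (ξ : CSpace n)) (w : CSpace n)‖ ^ 2) ^ n) ≤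
      ∑' k : ℕ, ENNReal.ofReal (((1 - r) / (2 ^ k * (1 - r)) ^ 2) ^ n) *
        (anisoCap ξ (2 ^ (k + 2) * (1 - r))).indicator 1 w := by
  have hδ : 0 < 1 - r := by linarith
  have hD := one_sub_le_norm_one_sub_herm hr0 ξ w
  set D := ‖1 - herm ((r : ℂ) • (ξ : CSpace n)) (w : CSpace n)‖ with hDdef
  -- With 2^k(1-r) ≤ D < 2^{k+1}(1-r), passing from rξ to ξ adds at most 1-r ≤ D, so w lies in the
  -- cap of radius 2^{k+2}(1-r).
  obtain ⟨k, hk1, hk2⟩ := exists_nat_pow_near ((one_le_div hδ).2 hD) one_lt_two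
  rw [le_div_iff₀ hδ] at hk1
  rw [div_lt_iff₀ hδ] at hk2
  have hmem : w ∈ anisoCap ξ (2 ^ (k + 2) * (1 - r)) := by
    change ‖1 - herm (w : CSpace n) (ξ : CSpace n)‖ < _
    rw [norm_one_sub_herm_comm]
    have e : 1 - herm (ξ : CSpace n) (w : CSpace n) =
        (1 - herm ((r : ℂ) • (ξ : CSpace n)) (w : CSpace n)) -
          ((1 - r : ℝ) : ℂ) * herm (ξ : CSpace n) (w : CSpace n) := by
      rw [herm_ofReal_smul_left]; push_cast; ring
    rw [e]
    refine (norm_sub_le _ _).trans_lt ?_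
    rw [norm_mul, Complex.norm_real, Real.norm_eq_abs, abs_of_pos hδ, ← hDdef]
    have h7 := norm_herm_le (ξ : CSpace n) (w : CSpace n)
    rw [norm_eq_of_mem_sphere, one_mul] at h7
    have := norm_lt_one_of_ball w
    have h8 : (2 : ℝ) ^ (k + 2) * (1 - r) = 2 * (2 ^ (k + 1) * (1 - r)) := by ring
    rw [h8]
    nlinarith
  refine le_trans ?_ (ENNReal.le_tsum k)
  rw [Set.indicator_of_mem hmem, Pi.one_apply, mul_one]
  apply ENNReal.ofReal_le_ofReal
  gcongr

/-- The dyadic caps may have radius at least 1; there the total mass suffices because δ^γ ≥ 1. -/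
lemma exists_caps_bound_of_lt_one {n : ℕ} [NeZero n] {p γ : ℝ} (hp : 0 < p) (hγ : 0 ≤ γ)
    (ν : Measure (UnitBall n)) [IsFiniteMeasure ν]
    (h : ∃ c : ℝ≥0, ∀ δ : ℝ, 0 < δ → δ < 1 →
        (∫⁻ ξ : UnitSphere n, ν (anisoCap ξ δ) ^ p ∂(sphereMeasure n)) ^ (1 / p) ≤
          (c : ℝ≥0∞) * ENNReal.ofReal (δ ^ γ)) :
    ∃ c : ℝ≥0, ∀ δ : ℝ, 0 < δ →
        ∫⁻ ξ : UnitSphere n, ν (anisoCap ξ δ) ^ p ∂(sphereMeasure n) ≤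
          ((c : ℝ≥0∞) * ENNReal.ofReal (δ ^ γ)) ^ p := by
  obtain ⟨c, hc⟩ := h
  refine ⟨c + (ν Set.univ).toNNReal, fun δ hδ => ?_⟩
  rw [← ENNReal.rpow_inv_le_iff hp, ← one_div]
  rw [ENNReal.coe_add, add_mul, ENNReal.coe_toNNReal (measure_ne_top _ _)]
  by_cases hδ1 : δ < 1
  · exact (hc δ hδ hδ1).trans (self_le_add_right _ _)
  · refine ((lintegral_anisoCap_le hp ν δ).trans ?_).trans (self_le_add_left _ _)
    apply le_mul_of_one_le_right zero_le
    rw [ENNReal.one_le_ofReal]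
    exact Real.one_le_rpow (not_lt.1 hδ1) hγ

lemma exists_poisson_mean_le {n : ℕ} {p γ : ℝ} (hp : 1 < p)
    (hγ' : γ < 2 * (n : ℝ)) (ν : Measure (UnitBall n)) [IsFiniteMeasure ν]
    (h : ∃ c : ℝ≥0, ∀ δ : ℝ, 0 < δ →
        ∫⁻ ξ : UnitSphere n, ν (anisoCap ξ δ) ^ p ∂(sphereMeasure n) ≤
          ((c : ℝ≥0∞) * ENNReal.ofReal (δ ^ γ)) ^ p) :
    ∃ c : ℝ≥0, ∀ r : ℝ, 0 ≤ r → r < 1 →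
      (∫⁻ ξ : UnitSphere n, (∫⁻ w, ENNReal.ofReal
            (((1 - r) / ‖1 - herm ((r : ℂ) • (ξ : CSpace n)) (w : CSpace n)‖ ^ 2) ^ n)
              ∂ν) ^ p ∂(sphereMeasure n)) ^ (1 / p) ≤
        c * ENNReal.ofReal ((1 - r) ^ (γ - (n : ℝ))) := by
  obtain ⟨c, hc⟩ := h
  have hp0 : 0 < p := by linarith
  set ρ : ℝ := 2 ^ (γ - 2 * (n : ℝ)) with hρ
  have hρ0 : 0 < ρ := by positivity
  have hρ1 : ρ < 1 := Real.rpow_lt_one_of_one_lt_of_neg one_lt_two (by linarith)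
  have hsum : ∑' k : ℕ, ENNReal.ofReal (ρ ^ k) ≠ ∞ := by
    rw [← ENNReal.ofReal_tsum_of_nonneg (fun k => by positivity)
      (summable_geometric_of_lt_one hρ0.le hρ1)]
    exact ENNReal.ofReal_ne_top
  refine ⟨((4 : ℝ) ^ γ).toNNReal * ((∑' k : ℕ, ENNReal.ofReal (ρ ^ k)).toNNReal * c),
    fun r hr0 hr1 => ?_⟩
  have hδ : 0 < 1 - r := by linarith
  set δ := 1 - r with hδdef
  -- Cap measures normalized so that their L^p norms are at most c for every k; what remains of the
  -- dyadic coefficient is then the geometric factor ρ^k.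
  let g : ℕ → UnitSphere n → ℝ≥0∞ := fun k ξ =>
    ENNReal.ofReal ((2 ^ (k + 2) * δ) ^ (-γ)) * ν (anisoCap ξ (2 ^ (k + 2) * δ))
  have hg (k) : Measurable (g k) := (measurable_measure_anisoCap ν _).const_mul _
  have hgB (k) : ∫⁻ ξ, g k ξ ^ p ∂(sphereMeasure n) ≤ (c : ℝ≥0∞) ^ p := by
    simp_rw [g, ENNReal.mul_rpow_of_nonneg _ _ hp0.le]
    rw [lintegral_const_mul' _ _ (ENNReal.rpow_ne_top_of_nonneg hp0.le ENNReal.ofReal_ne_top)]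
    refine (mul_le_mul' le_rfl (hc _ (by positivity))).trans_eq ?_
    rw [← ENNReal.mul_rpow_of_nonneg _ _ hp0.le, mul_left_comm,
      ← ENNReal.ofReal_mul (by positivity), ← Real.rpow_add (by positivity), neg_add_cancel,
      Real.rpow_zero, ENNReal.ofReal_one, mul_one]
  have hcoef (k : ℕ) : (δ / (2 ^ k * δ) ^ 2) ^ n =
      4 ^ γ * δ ^ (γ - (n : ℝ)) * (ρ ^ k * (2 ^ (k + 2) * δ) ^ (-γ)) := by
    rw [hρ, ← Real.rpow_mul_natCast zero_le_two, Real.mul_rpow (by positivity) hδ.le,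
      ← Real.rpow_natCast 2 (k + 2), ← Real.rpow_mul zero_le_two]
    have e4 : (4 : ℝ) ^ γ = 2 ^ (2 * γ) := by
      rw [Real.rpow_mul zero_le_two]; norm_num
    have e5 : δ / (2 ^ k * δ) ^ 2 = 2 ^ (-2 * (k : ℝ)) * δ ^ (-1 : ℝ) := by
      rw [show -2 * (k : ℝ) = -((2 * k : ℕ) : ℝ) by push_cast; ring, Real.rpow_neg zero_le_two,
        Real.rpow_natCast, Real.rpow_neg_one]
      field_simp
      ring
    rw [e4, e5, mul_pow, ← Real.rpow_mul_natCast zero_le_two, ← Real.rpow_mul_natCast hδ.le]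
    have e6 (a b c d e : ℝ) : (2 : ℝ) ^ a * δ ^ b * (2 ^ c * (2 ^ d * δ ^ e)) =
        2 ^ (a + c + d) * δ ^ (b + e) := by
      rw [Real.rpow_add hδ, Real.rpow_add two_pos, Real.rpow_add two_pos]; ring
    rw [e6]
    congr 2 <;> push_cast <;> ring
  have hpt (ξ : UnitSphere n) : ∫⁻ w, ENNReal.ofReal
      ((δ / ‖1 - herm ((r : ℂ) • (ξ : CSpace n)) (w : CSpace n)‖ ^ 2) ^ n) ∂ν ≤
      ENNReal.ofReal (4 ^ γ * δ ^ (γ - (n : ℝ))) * ∑' k, ENNReal.ofReal (ρ ^ k) * g k ξ := by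
    refine (lintegral_mono fun w => poissonKernel_le_tsum hr0 hr1 ξ w).trans_eq ?_
    rw [lintegral_tsum fun k => (Measurable.const_mul (measurable_one.indicator
      (measurableSet_anisoCap ξ _)) _).aemeasurable, ← ENNReal.tsum_mul_left]
    congr 1 with k
    rw [lintegral_const_mul _ (measurable_one.indicator (measurableSet_anisoCap ξ _)),
      lintegral_indicator_one (measurableSet_anisoCap ξ _), ← hδdef, hcoef,
      ENNReal.ofReal_mul (by positivity), ENNReal.ofReal_mul (p := ρ ^ k) (by positivity)]
    simp only [g]
    ring
  calc _ ≤ (∫⁻ ξ : UnitSphere n, (ENNReal.ofReal (4 ^ γ * δ ^ (γ - (n : ℝ))) *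
        ∑' k, ENNReal.ofReal (ρ ^ k) * g k ξ) ^ p ∂(sphereMeasure n)) ^ (1 / p) := by
        gcongr with ξ
        exact hpt ξ
    _ = ENNReal.ofReal (4 ^ γ * δ ^ (γ - (n : ℝ))) * (∫⁻ ξ : UnitSphere n,
        (∑' k, ENNReal.ofReal (ρ ^ k) * g k ξ) ^ p ∂(sphereMeasure n)) ^ (1 / p) :=
        lintegral_const_mul_rpow_rpow _ hp0 ENNReal.ofReal_ne_top _
    _ ≤ ENNReal.ofReal (4 ^ γ * δ ^ (γ - (n : ℝ))) *
        ((∑' k, ENNReal.ofReal (ρ ^ k)) ^ p * (c : ℝ≥0∞) ^ p) ^ (1 / p) := by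
        gcongr
        exact lintegral_tsum_rpow_le _ hp _ hg hgB
    _ = _ := by
        rw [← ENNReal.mul_rpow_of_nonneg _ _ hp0.le, ← ENNReal.rpow_mul, mul_one_div_cancel hp0.ne',
          ENNReal.rpow_one, ENNReal.ofReal_mul (by positivity), ENNReal.coe_mul, ENNReal.coe_mul,
          ENNReal.coe_toNNReal hsum, mul_right_comm]
        rfl

/-! ### The singular part -/

/-- Points of the ball at nonisotropic distance less than `δ` from `w`. -/
def ballCap {n : ℕ} (w : UnitBall n) (δ : ℝ) : Set (UnitBall n) :=
  {v | ‖1 - herm (v : CSpace n) (w : CSpace n)‖ < δ}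

lemma anisoCap_subset_ballCap {n : ℕ} {ξ : UnitSphere n} {w : UnitBall n} {δ : ℝ}
    (hw : w ∈ anisoCap ξ δ) : anisoCap ξ δ ⊆ ballCap w (6 * δ) := fun v hv =>
  norm_one_sub_herm_lt (norm_lt_one_of_ball v).le (norm_lt_one_of_ball w).le
    (norm_eq_of_mem_sphere ξ).le hv hw

lemma ballCap_subset_anisoCap {n : ℕ} {ξ : UnitSphere n} {w : UnitBall n} {δ : ℝ}
    (hw : w ∈ anisoCap ξ δ) : ballCap w δ ⊆ anisoCap ξ (6 * δ) := fun v hv => by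
  have hw' : ‖1 - herm (ξ : CSpace n) (w : CSpace n)‖ < δ := by
    rw [norm_one_sub_herm_comm]; exact hw
  exact norm_one_sub_herm_lt (norm_lt_one_of_ball v).le (norm_eq_of_mem_sphere ξ).le
    (norm_lt_one_of_ball w).le hv hw'

/-- The kernel is supported in the cap of radius 7(1-r) about ξ, and Jensen on that cap yields its
mass to the power p-1. Replacing it by the larger `ballCap` about w, of radius 42(1-r), makes the
factor independent of ξ, so the sphere integral can act on the kernel alone. -/
lemma rpow_lintegral_nearKernel_le {n : ℕ} {p : ℝ} (hp : 1 < p) (s : ℝ) {r : ℝ} (hr0 : 0 ≤ r)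
    (hr1 : r < 1) (ν : Measure (UnitBall n)) [IsFiniteMeasure ν] (ξ : UnitSphere n) :
    (∫⁻ w, nearKernel s ((r : ℂ) • (ξ : CSpace n)) (w : CSpace n) ∂ν) ^ p ≤
      ∫⁻ w, ν (ballCap w (42 * (1 - r))) ^ (p - 1) *
        nearKernel (s * p) ((r : ℂ) • (ξ : CSpace n)) (w : CSpace n) ∂ν := by
  have hmem (w : UnitBall n)
      (h : 3 / 4 < invRatio ((r : ℂ) • (ξ : CSpace n)) (w : CSpace n)) :
      w ∈ anisoCap ξ (7 * (1 - r)) :=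
    (comparable_of_lt_invRatio hr0 hr1 ξ (norm_lt_one_of_ball w) h).2.2.2
  have hrestrict : ∫⁻ w, nearKernel s ((r : ℂ) • (ξ : CSpace n)) (w : CSpace n) ∂ν =
      ∫⁻ w in anisoCap ξ (7 * (1 - r)),
        nearKernel s ((r : ℂ) • (ξ : CSpace n)) (w : CSpace n) ∂ν := by
    rw [← lintegral_indicator (measurableSet_anisoCap ξ _)]
    congr 1 with w
    by_cases h : 3 / 4 < invRatio ((r : ℂ) • (ξ : CSpace n)) (w : CSpace n)
    · rw [Set.indicator_of_mem (hmem w h)]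
    · have h0 : nearKernel s ((r : ℂ) • (ξ : CSpace n)) (w : CSpace n) = 0 := if_neg h
      rw [h0, eq_comm, Set.indicator_apply_eq_zero]
      exact fun _ => h0
  rw [hrestrict]
  refine (lintegral_rpow_le _ hp (measurable_nearKernel_right s r ξ)).trans ?_
  rw [Measure.restrict_apply_univ, ← lintegral_const_mul' _ _
    (ENNReal.rpow_ne_top_of_nonneg (by linarith) (measure_ne_top _ _))]
  refine (setLIntegral_le_lintegral _ _).trans (lintegral_mono fun w => ?_)
  rw [nearKernel_rpow (by linarith)]
  by_cases h : 3 / 4 < invRatio ((r : ℂ) • (ξ : CSpace n)) (w : CSpace n)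
  · have hsub := anisoCap_subset_ballCap (hmem w h)
    rw [show 6 * (7 * (1 - r)) = 42 * (1 - r) by ring] at hsub
    exact mul_le_mul' (ENNReal.rpow_le_rpow (measure_mono hsub) (by linarith)) le_rfl
  · rw [nearKernel, if_neg h, mul_zero, mul_zero]

lemma exists_near_mean_le {m : ℕ} (hm : 0 < m) {p γ : ℝ} (hp : 1 < p) (hpm : m * p < m + 1 / 2)
    (ν : Measure (UnitBall (m + 1))) [IsFiniteMeasure ν]
    (h : ∃ c : ℝ≥0, ∀ δ : ℝ, 0 < δ →
        ∫⁻ ξ : UnitSphere (m + 1), ν (anisoCap ξ δ) ^ p ∂(sphereMeasure (m + 1)) ≤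
          ((c : ℝ≥0∞) * ENNReal.ofReal (δ ^ γ)) ^ p) :
    ∃ c : ℝ≥0, ∀ r : ℝ, 1 - 1 / 36 ≤ r → r < 1 →
      (∫⁻ ξ : UnitSphere (m + 1), (∫⁻ w, nearKernel m ((r : ℂ) • (ξ : CSpace (m + 1)))
        (w : CSpace (m + 1)) ∂ν) ^ p ∂(sphereMeasure (m + 1))) ^ (1 / p) ≤
        c * ENNReal.ofReal ((1 - r) ^ γ) := by
  obtain ⟨c, hc⟩ := h
  have hp0 : 0 < p := by linarith
  have hm' : (1 : ℝ) ≤ m := by exact_mod_cast hm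
  obtain ⟨C, hC⟩ := exists_lintegral_nearKernel_le m hm (q := m * p) (by nlinarith) hpm
  refine ⟨C ^ (1 / p) * (c * ((252 : ℝ) ^ γ).toNNReal), fun r hr hr1 => ?_⟩
  have hδ : 0 < 1 - r := by linarith
  set S := sphereMeasure (m + 1)
  have hT : Measurable fun w : UnitBall (m + 1) => ν (ballCap w (42 * (1 - r))) ^ (p - 1) :=
    (measurable_measure_ballCap ν (42 * (1 - r))).pow_const _
  have hjoint : Measurable fun q : UnitSphere (m + 1) × UnitBall (m + 1) =>
      ν (ballCap q.2 (42 * (1 - r))) ^ (p - 1) *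
        nearKernel (m * p) ((r : ℂ) • (q.1 : CSpace (m + 1))) (q.2 : CSpace (m + 1)) :=
    (hT.comp measurable_snd).mul (measurable_nearKernel (m * p) r)
  have hleft (w : UnitBall (m + 1)) : Measurable fun ξ : UnitSphere (m + 1) =>
      nearKernel (m * p) ((r : ℂ) • (ξ : CSpace (m + 1))) (w : CSpace (m + 1)) := by
    have := (measurable_nearKernel (m * p) r).comp (measurable_prodMk_right (y := w))
    exact this
  have hpair : MeasurableSet {q : UnitSphere (m + 1) × UnitBall (m + 1) |
      ‖1 - herm (q.2 : CSpace (m + 1)) (q.1 : CSpace (m + 1))‖ < 42 * (1 - r)} := by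
    apply IsOpen.measurableSet
    exact isOpen_lt (by fun_prop) continuous_const
  -- The incidence relation between ξ and w is kept as an indicator on the product, so that the
  -- order of integration can be exchanged a second time.
  have hjoint2 : Measurable fun q : UnitSphere (m + 1) × UnitBall (m + 1) =>
      {q : UnitSphere (m + 1) × UnitBall (m + 1) |
        ‖1 - herm (q.2 : CSpace (m + 1)) (q.1 : CSpace (m + 1))‖ < 42 * (1 - r)}.indicator
        (fun q => ν (ballCap q.2 (42 * (1 - r))) ^ (p - 1)) q :=
    (hT.comp measurable_snd).indicator hpair
  have hmain : ∫⁻ ξ : UnitSphere (m + 1), (∫⁻ w, nearKernel m ((r : ℂ) • (ξ : CSpace (m + 1)))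
      (w : CSpace (m + 1)) ∂ν) ^ p ∂S ≤
      C * ∫⁻ ξ : UnitSphere (m + 1), ν (anisoCap ξ (252 * (1 - r))) ^ p ∂S := by
    calc _ ≤ ∫⁻ ξ : UnitSphere (m + 1), ∫⁻ w, ν (ballCap w (42 * (1 - r))) ^ (p - 1) *
          nearKernel (m * p) ((r : ℂ) • (ξ : CSpace (m + 1))) (w : CSpace (m + 1)) ∂ν ∂S :=
          lintegral_mono fun ξ => rpow_lintegral_nearKernel_le hp m (by linarith) hr1 ν ξ
      _ = ∫⁻ w, ∫⁻ ξ : UnitSphere (m + 1), ν (ballCap w (42 * (1 - r))) ^ (p - 1) *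
          nearKernel (m * p) ((r : ℂ) • (ξ : CSpace (m + 1))) (w : CSpace (m + 1)) ∂S ∂ν :=
          lintegral_lintegral_swap hjoint.aemeasurable
      _ ≤ ∫⁻ w, C * (∫⁻ ξ : UnitSphere (m + 1),
          {q : UnitSphere (m + 1) × UnitBall (m + 1) |
            ‖1 - herm (q.2 : CSpace (m + 1)) (q.1 : CSpace (m + 1))‖ < 42 * (1 - r)}.indicator
            (fun q => ν (ballCap q.2 (42 * (1 - r))) ^ (p - 1)) (ξ, w) ∂S) ∂ν := by
          refine lintegral_mono fun w => ?_
          rw [lintegral_const_mul _ (hleft w)]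
          refine (mul_le_mul' le_rfl (hC r hr hr1 w (norm_lt_one_of_ball w))).trans_eq ?_
          have hset : MeasurableSet {ξ : UnitSphere (m + 1) |
              ‖1 - herm (w : CSpace (m + 1)) (ξ : CSpace (m + 1))‖ < 42 * (1 - r)} := by
            apply IsOpen.measurableSet
            exact isOpen_lt (by fun_prop) continuous_const
          have e : ∫⁻ ξ : UnitSphere (m + 1),
              {q : UnitSphere (m + 1) × UnitBall (m + 1) |
                ‖1 - herm (q.2 : CSpace (m + 1)) (q.1 : CSpace (m + 1))‖ <
                  42 * (1 - r)}.indicator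
                (fun q => ν (ballCap q.2 (42 * (1 - r))) ^ (p - 1)) (ξ, w) ∂S =
              ∫⁻ _ξ in {ξ : UnitSphere (m + 1) |
                ‖1 - herm (w : CSpace (m + 1)) (ξ : CSpace (m + 1))‖ < 42 * (1 - r)},
                ν (ballCap w (42 * (1 - r))) ^ (p - 1) ∂S := by
            rw [← lintegral_indicator hset]
            rfl
          rw [e, setLIntegral_const]
          ring
      _ = C * ∫⁻ w, (∫⁻ ξ : UnitSphere (m + 1),
          {q : UnitSphere (m + 1) × UnitBall (m + 1) |
            ‖1 - herm (q.2 : CSpace (m + 1)) (q.1 : CSpace (m + 1))‖ < 42 * (1 - r)}.indicator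
            (fun q => ν (ballCap q.2 (42 * (1 - r))) ^ (p - 1)) (ξ, w) ∂S) ∂ν :=
          lintegral_const_mul' _ _ ENNReal.coe_ne_top
      _ = C * ∫⁻ ξ : UnitSphere (m + 1), (∫⁻ w,
          {q : UnitSphere (m + 1) × UnitBall (m + 1) |
            ‖1 - herm (q.2 : CSpace (m + 1)) (q.1 : CSpace (m + 1))‖ < 42 * (1 - r)}.indicator
            (fun q => ν (ballCap q.2 (42 * (1 - r))) ^ (p - 1)) (ξ, w) ∂ν) ∂S := by
          congr 1
          exact (lintegral_lintegral_swap hjoint2.aemeasurable).symm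
      _ ≤ _ := by
          refine mul_le_mul' le_rfl (lintegral_mono fun ξ => ?_)
          have e : ∫⁻ w, {q : UnitSphere (m + 1) × UnitBall (m + 1) |
              ‖1 - herm (q.2 : CSpace (m + 1)) (q.1 : CSpace (m + 1))‖ < 42 * (1 - r)}.indicator
              (fun q => ν (ballCap q.2 (42 * (1 - r))) ^ (p - 1)) (ξ, w) ∂ν =
              ∫⁻ w in anisoCap ξ (42 * (1 - r)), ν (ballCap w (42 * (1 - r))) ^ (p - 1) ∂ν := by
            rw [← lintegral_indicator (measurableSet_anisoCap ξ _)]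
            rfl
          rw [e]
          -- For w in the cap about ξ, its `ballCap` lies in the cap of radius 252(1-r) about ξ. The
          -- power p-1 and the ν-integral over w then combine into a p-th power.
          have h252 : 6 * (42 * (1 - r)) = 252 * (1 - r) := by ring
          calc _ ≤ ∫⁻ _w in anisoCap ξ (42 * (1 - r)),
                ν (anisoCap ξ (252 * (1 - r))) ^ (p - 1) ∂ν := by
                refine setLIntegral_mono' (measurableSet_anisoCap ξ _) fun w hw => ?_
                have hsub := ballCap_subset_anisoCap hw
                rw [h252] at hsub
                exact ENNReal.rpow_le_rpow (measure_mono hsub) (by linarith)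
            _ = ν (anisoCap ξ (252 * (1 - r))) ^ (p - 1) * ν (anisoCap ξ (42 * (1 - r))) :=
                setLIntegral_const _ _
            _ ≤ ν (anisoCap ξ (252 * (1 - r))) ^ (p - 1) *
                ν (anisoCap ξ (252 * (1 - r))) ^ (1 : ℝ) := by
                rw [ENNReal.rpow_one]
                refine mul_le_mul' le_rfl (measure_mono fun v hv => ?_)
                have hv' : ‖1 - herm (v : CSpace (m + 1)) (ξ : CSpace (m + 1))‖ < 42 * (1 - r) := hv
                change ‖1 - herm (v : CSpace (m + 1)) (ξ : CSpace (m + 1))‖ < 252 * (1 - r)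
                linarith
            _ = _ := by
                rw [← ENNReal.rpow_add_of_nonneg _ _ (by linarith) zero_le_one, sub_add_cancel]
  calc _ ≤ ((C : ℝ≥0∞) * ((c : ℝ≥0∞) * ENNReal.ofReal ((252 * (1 - r)) ^ γ)) ^ p) ^ (1 / p) := by
        gcongr
        exact hmain.trans (mul_le_mul' le_rfl (hc _ (by positivity)))
    _ = _ := by
        rw [ENNReal.mul_rpow_of_nonneg _ _ (by positivity), ← ENNReal.rpow_mul,
          mul_one_div_cancel hp0.ne', ENNReal.rpow_one, Real.mul_rpow (by norm_num) hδ.le,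
          ENNReal.ofReal_mul (by positivity), ENNReal.coe_mul, ENNReal.coe_mul,
          ← ENNReal.coe_rpow_of_nonneg _ (by positivity : 0 ≤ 1 / p), ENNReal.ofReal]
        ring

/-! ### Assembling the two parts -/

/-- The growth of the means of the potential follows from the estimate on nonisotropic balls. -/
lemma means_of_caps {m : ℕ} (hm : 0 < m) {p γ : ℝ} (hp : 1 < p) (hpm : m * p < m + 1 / 2)
    (hγ : 0 ≤ γ) (hγ' : γ < 2 * ((m + 1 : ℕ) : ℝ)) (μ : Measure (UnitBall (m + 1)))
    [IsFiniteMeasure (weightedMeasure μ)]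
    (h : ∃ c : ℝ≥0, ∀ δ : ℝ, 0 < δ → δ < 1 →
        (∫⁻ ξ : UnitSphere (m + 1), weightedMeasure μ (anisoCap ξ δ) ^ p
          ∂(sphereMeasure (m + 1))) ^ (1 / p) ≤ (c : ℝ≥0∞) * ENNReal.ofReal (δ ^ γ)) :
    ∃ c : ℝ≥0, ∀ᶠ r in 𝓝[<] (1 : ℝ), sphereMean p r (greenPotential μ) ≤
          (c : ℝ≥0∞) * ENNReal.ofReal ((1 - r) ^ (γ - ((m + 1 : ℕ) : ℝ))) := by
  have hp0 : 0 < p := by linarith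
  have hcaps := exists_caps_bound_of_lt_one hp0 hγ _ h
  obtain ⟨c₁, hc₁⟩ := exists_poisson_mean_le hp hγ' _ hcaps
  obtain ⟨c₂, hc₂⟩ := exists_near_mean_le hm hp hpm _ hcaps
  obtain ⟨C, hC⟩ := exists_greenPotential_le (m + 1) (by omega)
  refine ⟨C * (c₁ + c₂), ?_⟩
  filter_upwards [Ioo_mem_nhdsLT (show (1 : ℝ) - 1 / 36 < 1 by norm_num)] with r hr
  have hr1 : r < 1 := hr.2
  have hr0 : 0 ≤ r := by linarith [hr.1]
  have hδ : 0 < 1 - r := by linarith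
  have hcast : ((m + 1 : ℕ) : ℝ) - 1 = m := by push_cast; ring
  simp_rw [hcast] at hC
  set F : UnitSphere (m + 1) → ℝ≥0∞ := fun ξ => ∫⁻ w, ENNReal.ofReal
      (((1 - r) / ‖1 - herm ((r : ℂ) • (ξ : CSpace (m + 1))) (w : CSpace (m + 1))‖ ^ 2) ^ (m + 1))
        ∂(weightedMeasure μ) with hF
  set N : UnitSphere (m + 1) → ℝ≥0∞ := fun ξ => ∫⁻ w,
      nearKernel m ((r : ℂ) • (ξ : CSpace (m + 1))) (w : CSpace (m + 1))
        ∂(weightedMeasure μ) with hN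
  have hFm : Measurable F := by
    apply Measurable.lintegral_prod_right'
      (f := fun q : UnitSphere (m + 1) × UnitBall (m + 1) => ENNReal.ofReal (((1 - r) /
        ‖1 - herm ((r : ℂ) • (q.1 : CSpace (m + 1))) (q.2 : CSpace (m + 1))‖ ^ 2) ^ (m + 1)))
    refine ((measurable_const.div ?_).pow_const _).ennreal_ofReal
    exact Continuous.measurable (by fun_prop)
  have hNm : Measurable N := (measurable_nearKernel m r).lintegral_prod_right'
  calc sphereMean p r (greenPotential μ)
      ≤ (∫⁻ ξ, (C * (F + fun ξ => ENNReal.ofReal (((1 - r) ^ (m + 1))⁻¹) * N ξ) ξ) ^ p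
          ∂(sphereMeasure (m + 1))) ^ (1 / p) := by
        rw [sphereMean]
        gcongr with ξ
        exact hC μ r hr0 hr1 ξ
    _ = C * (∫⁻ ξ, ((F + fun ξ => ENNReal.ofReal (((1 - r) ^ (m + 1))⁻¹) * N ξ) ξ) ^ p
          ∂(sphereMeasure (m + 1))) ^ (1 / p) :=
        lintegral_const_mul_rpow_rpow _ hp0 ENNReal.coe_ne_top _
    _ ≤ C * ((∫⁻ ξ, F ξ ^ p ∂(sphereMeasure (m + 1))) ^ (1 / p) +
        (∫⁻ ξ, (ENNReal.ofReal (((1 - r) ^ (m + 1))⁻¹) * N ξ) ^ p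
          ∂(sphereMeasure (m + 1))) ^ (1 / p)) := by
        gcongr
        exact ENNReal.lintegral_Lp_add_le hFm.aemeasurable (hNm.const_mul _).aemeasurable hp.le
    _ ≤ C * (c₁ * ENNReal.ofReal ((1 - r) ^ (γ - ((m + 1 : ℕ) : ℝ))) +
        ENNReal.ofReal (((1 - r) ^ (m + 1))⁻¹) * (c₂ * ENNReal.ofReal ((1 - r) ^ γ))) := by
        rw [lintegral_const_mul_rpow_rpow _ hp0 ENNReal.ofReal_ne_top]
        gcongr
        · exact hc₁ r hr0 hr1
        · exact hc₂ r hr.1.le hr1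
    _ = _ := by
        rw [mul_left_comm (ENNReal.ofReal _) (c₂ : ℝ≥0∞), ← ENNReal.ofReal_mul (by positivity),
          ← Real.rpow_natCast, ← Real.rpow_neg hδ.le, ← Real.rpow_add hδ, neg_add_eq_sub,
          ← add_mul, ENNReal.coe_mul, ENNReal.coe_add, mul_assoc]

end InvariantGreen

theorem theorem1 (n : ℕ) (hn : 1 < n) (p γ : ℝ) (hp : 1 < p)
    (hp' : p < (2 * (n : ℝ) - 1) / (2 * ((n : ℝ) - 1)))
    (hγ : 0 ≤ γ) (hγ' : γ < 2 * (n : ℝ))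
    (μ : Measure (InvariantGreen.UnitBall n))
    (hμ : ∫⁻ w, ENNReal.ofReal ((1 - ‖(w : InvariantGreen.CSpace n)‖ ^ 2) ^ n) ∂μ < ∞) :
    (∃ c : ℝ≥0, ∀ᶠ r in 𝓝[<] (1 : ℝ),
        InvariantGreen.sphereMean p r (InvariantGreen.greenPotential μ) ≤
          (c : ℝ≥0∞) * ENNReal.ofReal ((1 - r) ^ (γ - (n : ℝ)))) ↔
    (∃ c : ℝ≥0, ∀ δ : ℝ, 0 < δ → δ < 1 →
        (∫⁻ ξ : InvariantGreen.UnitSphere n,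
            InvariantGreen.weightedMeasure μ (InvariantGreen.anisoCap ξ δ) ^ p
              ∂(InvariantGreen.sphereMeasure n)) ^ (1 / p) ≤
          (c : ℝ≥0∞) * ENNReal.ofReal (δ ^ γ)) := by
  have := InvariantGreen.isFiniteMeasure_weightedMeasure μ hμ
  refine ⟨InvariantGreen.caps_of_means hn hp hγ μ, ?_⟩
  obtain ⟨m, rfl⟩ : ∃ m, n = m + 1 := ⟨n - 1, by omega⟩
  have hm : (0 : ℝ) < m := by exact_mod_cast (by omega : 0 < m)
  refine InvariantGreen.means_of_caps (by omega) hp ?_ hγ hγ' μ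
  -- For n = m+1 the condition on p reads p < (2m+1)/(2m), that is mp < m + 1/2.
  push_cast at hp'
  rw [add_sub_cancel_right, lt_div_iff₀ (by positivity)] at hp'
  linarith
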